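/- Let $n \ge 0$ and regard the symmetric group $S_n$ as a Coxeter group with simple generators $s_1,\dots,s_{n-1}$, where $s_i$ is the adjacent transposition $(i\; i+1)$; its Dynkin diagram is the path with vertices $s_1,\dots,s_{n-1}$, in which $s_i$ and $s_j$ are adjacent if and only if $|i-j|=1$. For $w\in S_n$ let $\ell(w)$ be the minimal length of a word in the simple generators with product $w$; a word of this length with product $w$ is a reduced word of $w$. Let $J(w)=\{s_i : \ell(s_iw)<\ell(w)\}$ be the left descent set of $w$, and for a set $C$ of simple generators let $w_0(C)$ be the element of maximal length in the subgroup of $S_n$ generated by $C$. The permutation $w$ is called spherical if it has a reduced word $s_{i_1}\cdots s_{i_{\ell(w)}}$ such that (S.1) $|\{t : s_{i_t}=s_j\}|\le 1$ for every $s_j\notin J(w)$, and (S.2) $|\{t : s_{i_t}\in C\}|\le \ell(w_0(C))+|C|$ for every connected component $C$ of the subgraph of the Dynkin diagram induced on $J(w)$. A permutation $w=w_1\ldots w_n\in S_n$ avoids $p=p_1\ldots p_k\in S_k$ if there are no positions $1\le i_1<\cdots<i_k\le n$ such that $w_{i_1}\ldots w_{i_k}$ are in the same relative order as $p_1\ldots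 p_k$. **Theorem.** A permutation $w\in S_n$ is spherical if and only if it avoids all twenty-one patterns in $$\begin{aligned}P=\{&24531,25314,25341,34512,34521,35412,35421,42531,45123,45213,45231,\\&45312,52314,52341,53124,53142,53412,53421,54123,54213,54231\}.\end{aligned}$$ -/

import Mathlib

namespace Spherical

/-- The adjacent transposition `s_i` of the symmetric group on `n` letters. The index set of the
simple generators is `Fin (n - 1)`; both the letters and the generators are numbered from `0`, so
`simple i` exchanges the letters `i` and `i + 1`. -/
def simple {n : ℕ} (i : Fin (n - 1)) : Equiv.Perm (Fin n) :=
  Equiv.swap ⟨i.1, by have := i.2; omega⟩ ⟨i.1 + 1, by have := i.2; omega⟩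

/-- The product `s_{i_1} ⋯ s_{i_l}` of a word in the simple generators. Products of permutations
are compositions of functions, `(u * v) x = u (v x)`. -/
def wordProd {n : ℕ} (l : List (Fin (n - 1))) : Equiv.Perm (Fin n) :=
  (l.map simple).prod

/-- The Coxeter length: the least length of a word in the simple generators with product `w`. -/
noncomputable def length {n : ℕ} (w : Equiv.Perm (Fin n)) : ℕ :=
  sInf {k : ℕ | ∃ l : List (Fin (n - 1)), wordProd l = w ∧ l.length = k}

/-- Words of minimum length for `w`. -/
def IsReducedWord {n : ℕ} (w : Equiv.Perm (Fin n)) (l : List (Fin (n - 1))) : Prop :=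
  wordProd l = w ∧ l.length = length w

/-- The left descent set `J(w)`. -/
def leftDescents {n : ℕ} (w : Equiv.Perm (Fin n)) : Set (Fin (n - 1)) :=
  {i | length (simple i * w) < length w}

/-- The subgroup generated by the simple generators in `J`. -/
def parabolic {n : ℕ} (J : Set (Fin (n - 1))) : Subgroup (Equiv.Perm (Fin n)) :=
  Subgroup.closure (simple '' J)

theorem exists_longest {n : ℕ} (J : Set (Fin (n - 1))) :
    ∃ u ∈ parabolic J, ∀ v ∈ parabolic J, length v ≤ length u := by
  obtain ⟨u, hu⟩ := Finite.exists_max (fun v : parabolic J => length v.1)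
  exact ⟨u.1, u.2, fun v hv => hu ⟨v, hv⟩⟩

/-- `w_0(J)`: the element of maximum length of the subgroup generated by `J`. -/
noncomputable def longest {n : ℕ} (J : Set (Fin (n - 1))) : Equiv.Perm (Fin n) :=
  (exists_longest J).choose

/-- The Dynkin diagram of the symmetric group: the path on the simple generators, in which two of
them are adjacent exactly when their indices differ by one. -/
def dynkin (n : ℕ) : SimpleGraph (Fin (n - 1)) :=
  SimpleGraph.pathGraph (n - 1)

/-- The set of simple generators that make up a connected component of the subgraph of the Dynkin
diagram induced on `J`. -/
def componentSet {n : ℕ} {J : Set (Fin (n - 1))}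
    (C : ((dynkin n).induce J).ConnectedComponent) : Set (Fin (n - 1)) :=
  Subtype.val '' C.supp

open Classical in
/-- The number of positions `t` of the word at which the letter lies in `C`. -/
noncomputable def countIn {n : ℕ} (l : List (Fin (n - 1))) (C : Set (Fin (n - 1))) : ℕ :=
  l.countP (fun i => decide (i ∈ C))

/-- Spherical permutations: some reduced word uses every generator outside `J(w)` at most once, and
uses at most `ℓ(w_0(C)) + |C|` letters from each connected component `C` of the induced subgraph
of the Dynkin diagram on `J(w)`. -/
def IsSpherical {n : ℕ} (w : Equiv.Perm (Fin n)) : Prop :=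
  ∃ l : List (Fin (n - 1)), IsReducedWord w l ∧
    (∀ j, j ∉ leftDescents w → l.count j ≤ 1) ∧
    ∀ C : ((dynkin n).induce (leftDescents w)).ConnectedComponent,
      countIn l (componentSet C) ≤ length (longest (componentSet C)) + (componentSet C).ncard

/-- `w` has an occurrence of the pattern `p`: at some positions `f 0 < ⋯ < f (k - 1)` the values of
`w` are in the same relative order as the values of `p`. -/
def ContainsPattern {n k : ℕ} (w : Equiv.Perm (Fin n)) (p : Equiv.Perm (Fin k)) : Prop :=
  ∃ f : Fin k → Fin n, StrictMono f ∧ ∀ a b, w (f a) < w (f b) ↔ p a < p b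

/-- `w` avoids the pattern `p`. -/
def Avoids {n k : ℕ} (w : Equiv.Perm (Fin n)) (p : Equiv.Perm (Fin k)) : Prop :=
  ¬ ContainsPattern w p

/-- One-line notation, with the usual values `1, …, k`. -/
def oneLine {k : ℕ} (p : Equiv.Perm (Fin k)) : List ℕ :=
  List.ofFn fun i => (p i : ℕ) + 1

/-- The twenty-one patterns. -/
def patterns : Set (Equiv.Perm (Fin 5)) :=
  {p | oneLine p ∈ ([
    [2, 4, 5, 3, 1], [2, 5, 3, 1, 4], [2, 5, 3, 4, 1], [3, 4, 5, 1, 2], [3, 4, 5, 2, 1],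
    [3, 5, 4, 1, 2], [3, 5, 4, 2, 1], [4, 2, 5, 3, 1], [4, 5, 1, 2, 3], [4, 5, 2, 1, 3],
    [4, 5, 2, 3, 1], [4, 5, 3, 1, 2], [5, 2, 3, 1, 4], [5, 2, 3, 4, 1], [5, 3, 1, 2, 4],
    [5, 3, 1, 4, 2], [5, 3, 4, 1, 2], [5, 3, 4, 2, 1], [5, 4, 1, 2, 3], [5, 4, 2, 1, 3],
    [5, 4, 2, 3, 1]] : List (List ℕ))}

end Spherical

namespace Spherical

/-! Put v = w⁻¹. Then s_k is a left descent of w exactly when v(k+1) < v(k), so the components of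
J(w) are the nontrivial decreasing runs of v. Passing to inverses turns the twenty-one patterns into
two configurations in v: a decreasing subsequence of length three with entries in three different
runs, and two entries before an ascent that both exceed two entries after it
(`avoids_patterns_iff`).

Suppose both are absent. Write w = x u with x in the parabolic subgroup of J(w), lengths adding, and
u without left descents in J(w). Every inversion of u⁻¹ straddles an ascent of v, and x moves
nothing across that ascent, so a 321 or 3412 in u⁻¹ would give one of the two configurations in v.
Hence u has a word without repeated letters (`exists_nodup_word`), while x costs at most ℓ(w₀(C))
letters in each component C.

Conversely, read a reduced word as a sequence of adjacent exchanges of balls: ball i ends at v(i),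
and every inverted pair is exchanged exactly once. By (S.1) a barrier at an ascent of v is crossed
at most once, hence by at most one ball in each direction. This excludes the separated pairs. For a
separated triple γ, β, α, count the exchanges at letters of the run of β: besides all pairs of balls
of the run there are at least |C| + 1 exchanges that involve γ or α, one more than (S.2) permits
(`not_separatedTriple_of_isSpherical`). -/

variable {n : ℕ}

/-! ### Words and Coxeter length -/

theorem simple_val (k : Fin (n - 1)) (i : Fin n) :
    ((simple k i : Fin n) : ℕ) =
      if (i : ℕ) = k then (k : ℕ) + 1 else if (i : ℕ) = k + 1 then (k : ℕ) else i := by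
  simp only [simple, Equiv.swap_apply_def, Fin.ext_iff]
  split_ifs <;> rfl

@[simp] theorem simple_mul_self (k : Fin (n - 1)) : simple k * simple k = 1 :=
  Equiv.swap_mul_self _ _

@[simp] theorem simple_inv (k : Fin (n - 1)) : (simple k)⁻¹ = simple k :=
  Equiv.swap_inv _ _

@[simp] theorem simple_simple (k : Fin (n - 1)) (i : Fin n) : simple k (simple k i) = i :=
  Equiv.swap_apply_self _ _ _

@[simp] theorem wordProd_nil : wordProd ([] : List (Fin (n - 1))) = 1 := rfl

@[simp] theorem wordProd_cons (k : Fin (n - 1)) (l : List (Fin (n - 1))) :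
    wordProd (k :: l) = simple k * wordProd l := by simp [wordProd]

@[simp] theorem wordProd_append (l l' : List (Fin (n - 1))) :
    wordProd (l ++ l') = wordProd l * wordProd l' := by simp [wordProd]

theorem wordProd_reverse (l : List (Fin (n - 1))) : wordProd l.reverse = (wordProd l)⁻¹ := by
  induction l with
  | nil => simp
  | cons k l ih => simp [ih]

theorem exists_wordProd (w : Equiv.Perm (Fin n)) : ∃ l, wordProd l = w := by
  obtain _ | n := n
  · exact ⟨[], Subsingleton.elim _ _⟩
  · have h : w ∈ Submonoid.closure
        (Set.range fun i : Fin n ↦ Equiv.swap i.castSucc i.succ) := by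
      rw [Equiv.Perm.mclosure_swap_castSucc_succ]; trivial
    induction h using Submonoid.closure_induction with
    | mem x hx => obtain ⟨i, rfl⟩ := hx; exact ⟨[i], by simp; rfl⟩
    | one => exact ⟨[], rfl⟩
    | mul x y _ _ hx hy =>
      obtain ⟨a, rfl⟩ := hx
      obtain ⟨b, rfl⟩ := hy
      exact ⟨a ++ b, wordProd_append a b⟩

theorem length_le_of_wordProd {w : Equiv.Perm (Fin n)} {l : List (Fin (n - 1))}
    (h : wordProd l = w) : length w ≤ l.length :=
  Nat.sInf_le ⟨l, h, rfl⟩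

theorem exists_isReducedWord (w : Equiv.Perm (Fin n)) : ∃ l, IsReducedWord w l := by
  obtain ⟨l, hl⟩ := exists_wordProd w
  exact Nat.sInf_mem (s := {k : ℕ | ∃ l : List (Fin (n - 1)), wordProd l = w ∧ l.length = k})
    ⟨_, l, hl, rfl⟩

/-! ### Reduced words as exchanges of balls -/

/-- Read a word from left to right, letting each letter `k` exchange the contents of the positions
`k` and `k + 1`: `pos l t i` is the position, after `t` letters, of the ball that starts at `i`. -/
def pos (l : List (Fin (n - 1))) (t : ℕ) : Equiv.Perm (Fin n) := (wordProd (l.take t))⁻¹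

@[simp] theorem pos_zero (l : List (Fin (n - 1))) : pos l 0 = 1 := by simp [pos]

@[simp] theorem pos_length (l : List (Fin (n - 1))) : pos l l.length = (wordProd l)⁻¹ := by
  simp [pos]

theorem pos_succ {l : List (Fin (n - 1))} {t : ℕ} (h : t < l.length) :
    pos l (t + 1) = simple l[t] * pos l t := by
  rw [pos, pos, ← List.take_append_getElem h, wordProd_append]
  simp

/-- The letter number `t` exchanges the ball `i`, on the left, with the ball `j`. -/
def SwapAt (l : List (Fin (n - 1))) (t : ℕ) (i j : Fin n) : Prop :=
  ∃ h : t < l.length, (pos l t i : ℕ) = l[t] ∧ (pos l t j : ℕ) = l[t] + 1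

theorem SwapAt.after {l : List (Fin (n - 1))} {t : ℕ} {i j : Fin n} (h : SwapAt l t i j) :
    (pos l (t + 1) i : ℕ) = pos l t j ∧ (pos l (t + 1) j : ℕ) = pos l t i := by
  obtain ⟨ht, hi, hj⟩ := h
  simp [pos_succ ht, simple_val, hi, hj]

theorem exists_change {A : ℕ → Prop} {a b : ℕ} (hab : a ≤ b) (ha : A a) (hb : ¬ A b) :
    ∃ t, a ≤ t ∧ t < b ∧ A t ∧ ¬ A (t + 1) := by
  induction b, hab using Nat.le_induction with
  | base => exact absurd ha hb
  | succ b hab ih =>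
    by_cases h : A b
    · exact ⟨b, hab, by omega, h, hb⟩
    · obtain ⟨t, h1, h2, h3⟩ := ih h
      exact ⟨t, h1, by omega, h3⟩

theorem exists_swapAt {l : List (Fin (n - 1))} {a b : ℕ} {i j : Fin n} (hab : a ≤ b)
    (hb : b ≤ l.length) (h0 : pos l a i < pos l a j) (h1 : pos l b j < pos l b i) :
    ∃ t, a ≤ t ∧ t < b ∧ SwapAt l t i j := by
  obtain ⟨t, hat, htb, h, h'⟩ := exists_change (A := fun t => pos l t i < pos l t j) hab h0
    (not_lt_of_gt h1)
  refine ⟨t, hat, htb, by omega, ?_⟩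
  have ht : t < l.length := by omega
  simp only [pos_succ ht, Equiv.Perm.mul_apply, Fin.lt_def, simple_val] at h h'
  split_ifs at h' <;> omega

/-- Conjugating the letter by the prefix before it gives the reflection that transposes the labels
of the two balls. -/
theorem SwapAt.wordProd_eraseIdx {l : List (Fin (n - 1))} {t : ℕ} {i j : Fin n}
    (h : SwapAt l t i j) : wordProd (l.eraseIdx t) = Equiv.swap i j * wordProd l := by
  obtain ⟨ht, hi, hj⟩ := h
  have e : l = l.take t ++ l[t] :: l.drop (t + 1) := by simp
  have hs : simple l[t] = Equiv.swap (pos l t i) (pos l t j) := by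
    unfold simple
    congr 1
    · exact Fin.ext hi.symm
    · exact Fin.ext hj.symm
  have hsw : Equiv.swap i j = wordProd (l.take t) * simple l[t] * (wordProd (l.take t))⁻¹ := by
    rw [hs, Equiv.swap_apply_apply]
    simp [pos, mul_assoc]
  rw [hsw, List.eraseIdx_eq_take_drop_succ]
  conv_rhs => arg 2; rw [e]
  simp only [wordProd_append, wordProd_cons]
  simp only [mul_assoc, inv_mul_cancel_left]
  rw [← mul_assoc (simple l[t]) (simple l[t]), simple_mul_self, one_mul]

theorem pos_eraseIdx {l : List (Fin (n - 1))} {s t : ℕ} (h : t ≤ s) :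
    pos (l.eraseIdx s) t = pos l t := by
  simp [pos, List.take_eraseIdx_eq_take_of_le _ _ _ h]

theorem SwapAt.eraseIdx {l : List (Fin (n - 1))} {s t : ℕ} {i j : Fin n} (h : SwapAt l t i j)
    (hts : t < s) (hs : s < l.length) : SwapAt (l.eraseIdx s) t i j := by
  obtain ⟨ht, hi, hj⟩ := h
  refine ⟨by rw [List.length_eraseIdx_of_lt hs]; omega, ?_⟩
  rw [pos_eraseIdx hts.le, List.getElem_eraseIdx_of_lt _ hts]
  exact ⟨hi, hj⟩

/-- Deleting both letters multiplies the product by the same transposition twice, which leaves a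
word for w that is shorter by two. The later letter goes first, since this does not affect the
positions at time t. -/
theorem IsReducedWord.not_swap_twice {w : Equiv.Perm (Fin n)} {l : List (Fin (n - 1))}
    (hl : IsReducedWord w l) {s t : ℕ} {i j i' j' : Fin n} (hst : t < s) (ht : SwapAt l t i j)
    (hs : SwapAt l s i' j') (e : Equiv.swap i j = Equiv.swap i' j') : False := by
  have hs' : s < l.length := hs.1
  have h1 := (ht.eraseIdx hst hs').wordProd_eraseIdx
  rw [hs.wordProd_eraseIdx, e, ← mul_assoc, Equiv.swap_mul_self, one_mul, hl.1] at h1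
  have := length_le_of_wordProd h1
  rw [List.length_eraseIdx_of_lt, List.length_eraseIdx_of_lt hs', ← hl.2] at this
  · omega
  · rw [List.length_eraseIdx_of_lt hs']; omega

theorem IsReducedWord.swapAt_unique {w : Equiv.Perm (Fin n)} {l : List (Fin (n - 1))}
    (hl : IsReducedWord w l) {s t : ℕ} {i j : Fin n} (ht : SwapAt l t i j)
    (hs : SwapAt l s i j) : s = t := by
  rcases lt_trichotomy s t with h | h | h
  · exact (hl.not_swap_twice h hs ht rfl).elim
  · exact h
  · exact (hl.not_swap_twice h ht hs rfl).elim

theorem SwapAt.ne {l : List (Fin (n - 1))} {t : ℕ} {i j : Fin n} (h : SwapAt l t i j) :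
    i ≠ j := by
  rintro rfl
  obtain ⟨_, h1, h2⟩ := h
  omega

/-- If j started on the left of i, the two balls would already have been exchanged once. -/
theorem IsReducedWord.swapAt_lt {w : Equiv.Perm (Fin n)} {l : List (Fin (n - 1))}
    (hl : IsReducedWord w l) {t : ℕ} {i j : Fin n} (ht : SwapAt l t i j) : i < j := by
  by_contra h
  have hji : j < i := lt_of_le_of_ne (not_lt.mp h) ht.ne.symm
  have ht' := ht
  obtain ⟨h0, h1, h2⟩ := ht'
  obtain ⟨s, -, hs, hs'⟩ := exists_swapAt (l := l) (i := j) (j := i) (Nat.zero_le t) (by omega)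
    (by simpa using hji) (by rw [Fin.lt_def]; omega)
  exact hl.not_swap_twice hs hs' ht (Equiv.swap_comm _ _)

theorem IsReducedWord.swapAt_inversion {w : Equiv.Perm (Fin n)} {l : List (Fin (n - 1))}
    (hl : IsReducedWord w l) {t : ℕ} {i j : Fin n} (ht : SwapAt l t i j) : w⁻¹ j < w⁻¹ i := by
  by_contra h
  have hij : w⁻¹ i < w⁻¹ j := lt_of_le_of_ne (not_lt.mp h) (w⁻¹.injective.ne ht.ne)
  have h0 : t < l.length := ht.1
  have h1 := ht.after
  have h2 := ht.2
  obtain ⟨s, hs, -, hs'⟩ := exists_swapAt (l := l) (i := j) (j := i) (a := t + 1) (b := l.length)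
    (by omega) le_rfl (by rw [Fin.lt_def]; omega) (by rw [pos_length, hl.1]; exact hij)
  exact hl.not_swap_twice (by omega) ht hs' (Equiv.swap_comm _ _)

theorem exists_swapAt_of_inversion {w : Equiv.Perm (Fin n)} {l : List (Fin (n - 1))}
    (hl : wordProd l = w) {i j : Fin n} (hij : i < j) (h : w⁻¹ j < w⁻¹ i) :
    ∃ t, SwapAt l t i j := by
  obtain ⟨t, -, -, ht⟩ := exists_swapAt (l := l) (i := i) (j := j) (Nat.zero_le l.length) le_rfl
    (by simpa using hij) (by rw [pos_length, hl]; exact h)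
  exact ⟨t, ht⟩

/-- The exchange that the letter number `t` performs. -/
theorem exists_swapAt_time (l : List (Fin (n - 1))) {t : ℕ} (ht : t < l.length) :
    ∃ i j, SwapAt l t i j := by
  have := l[t].2
  exact ⟨(pos l t)⁻¹ ⟨l[t], by omega⟩, (pos l t)⁻¹ ⟨l[t] + 1, by omega⟩, ht, by simp, by simp⟩

theorem SwapAt.pair_unique {l : List (Fin (n - 1))} {t : ℕ} {i j i' j' : Fin n}
    (h : SwapAt l t i j) (h' : SwapAt l t i' j') : i = i' ∧ j = j' := by
  obtain ⟨_, h1, h2⟩ := h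
  obtain ⟨_, h3, h4⟩ := h'
  exact ⟨(pos l t).injective (Fin.ext (by omega)), (pos l t).injective (Fin.ext (by omega))⟩

theorem mem_leftDescents {w : Equiv.Perm (Fin n)} {k : Fin (n - 1)} {i j : Fin n}
    (hi : (i : ℕ) = k) (hj : (j : ℕ) = k + 1) : k ∈ leftDescents w ↔ w⁻¹ j < w⁻¹ i := by
  have hs : simple k = Equiv.swap i j := by
    unfold simple
    congr 1
    · exact Fin.ext hi.symm
    · exact Fin.ext hj.symm
  constructor
  · intro h
    obtain ⟨l, hl⟩ := exists_isReducedWord (simple k * w)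
    have hw : wordProd (k :: l) = w := by rw [wordProd_cons, hl.1, ← mul_assoc]; simp
    have hr : IsReducedWord w (k :: l) := by
      refine ⟨hw, le_antisymm ?_ (length_le_of_wordProd hw)⟩
      have : length (simple k * w) < length w := h
      rw [List.length_cons, hl.2]
      omega
    exact hr.swapAt_inversion (t := 0) ⟨by simp, by simp [hi], by simp [hj]⟩
  · intro h
    obtain ⟨l, hl⟩ := exists_isReducedWord w
    obtain ⟨t, ht⟩ := exists_swapAt_of_inversion hl.1 (by rw [Fin.lt_def]; omega) h
    have h1 := ht.wordProd_eraseIdx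
    rw [← hs, hl.1] at h1
    have h2 := length_le_of_wordProd h1
    have h3 : t < l.length := ht.1
    rw [List.length_eraseIdx_of_lt h3, ← hl.2.symm] at h2
    show length (simple k * w) < length w
    have := hl.2
    omega

/-- Each letter of a reduced word exchanges a pair inverted by w⁻¹, and no pair is exchanged twice.
-/
theorem length_le_card_inversions (w : Equiv.Perm (Fin n)) :
    length w ≤ (Finset.univ.filter fun e : Fin n × Fin n => e.1 < e.2 ∧ w⁻¹ e.2 < w⁻¹ e.1).card := by
  obtain ⟨l, hl⟩ := exists_isReducedWord w
  choose i j hij using fun t : Fin l.length => exists_swapAt_time l t.2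
  rw [← hl.2, ← Fintype.card_fin l.length, ← Finset.card_univ]
  refine Finset.card_le_card_of_injOn (fun t => (i t, j t)) (fun t _ => ?_) (fun s _ t _ h => ?_)
  · simpa using ⟨hl.swapAt_lt (hij t), hl.swapAt_inversion (hij t)⟩
  · simp only [Prod.mk.injEq] at h
    have hs := hij s
    rw [h.1, h.2] at hs
    exact Fin.ext (hl.swapAt_unique (hij t) hs)

theorem card_le_countP {α : Type*} {p : α → Bool} (l : List α) :
    ∀ S : Finset ℕ, (∀ t ∈ S, ∃ h : t < l.length, p l[t]) → S.card ≤ l.countP p := by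
  induction l using List.reverseRecOn with
  | nil =>
    intro S hS
    rw [Finset.eq_empty_of_forall_notMem (s := S) fun t ht => by simpa using hS t ht]
    simp
  | append_singleton l a ih =>
    intro S hS
    have h1 : (S.erase l.length).card ≤ l.countP p := by
      refine ih _ fun t ht => ?_
      obtain ⟨hne, ht⟩ := Finset.mem_erase.mp ht
      obtain ⟨h, hp⟩ := hS t ht
      have h' : t < l.length := by
        simp only [List.length_append, List.length_singleton] at h; omega
      exact ⟨h', by simpa [List.getElem_append_left h'] using hp⟩
    rw [List.countP_append]
    by_cases hm : l.length ∈ S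
    · obtain ⟨h, hp⟩ := hS _ hm
      have := Finset.card_erase_of_mem hm
      have h2 : List.countP p [a] = 1 := by
        simp at hp; simp [hp]
      omega
    · rw [Finset.erase_eq_of_notMem hm] at h1
      omega

/-- The pairs of balls that are exchanged by a letter in `C` number at most as many as these
letters. -/
theorem card_swaps_le_countIn {l : List (Fin (n - 1))} {C : Set (Fin (n - 1))}
    (E : Finset (Fin n × Fin n))
    (hE : ∀ e ∈ E, ∃ t, ∃ h : t < l.length, SwapAt l t e.1 e.2 ∧ l[t] ∈ C) :
    E.card ≤ countIn l C := by
  classical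
  choose! T hT using hE
  have hinj : Set.InjOn T E := by
    intro e he e' he' h
    obtain ⟨_, h1, -⟩ := hT e he
    obtain ⟨_, h2, -⟩ := hT e' he'
    rw [h] at h1
    exact Prod.ext (h1.pair_unique h2).1 (h1.pair_unique h2).2
  rw [← Finset.card_image_of_injOn hinj]
  refine card_le_countP l _ fun t ht => ?_
  obtain ⟨e, he, rfl⟩ := Finset.mem_image.mp ht
  obtain ⟨h, -, h'⟩ := hT e he
  exact ⟨h, by simpa using h'⟩

/-! ### The patterns in terms of w⁻¹ -/

/-- Five values `c, x, b, y, a` with `c > b > a`, where `c, x, b` and `b, y, a` are not decreasing. -/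
def SplitDecreasing {α : Type*} [LT α] (h : Fin 5 → α) : Prop :=
  (h 4 < h 2 ∧ h 2 < h 0) ∧ (h 0 < h 1 ∨ h 1 < h 2) ∧ (h 2 < h 3 ∨ h 3 < h 4)

/-- Five values `p, q, x, r, s` with `p, q > r, s`, where `q, x, r` is not decreasing. -/
def SplitPairs {α : Type*} [LT α] (h : Fin 5 → α) : Prop :=
  (h 3 < h 0 ∧ h 3 < h 1 ∧ h 4 < h 0 ∧ h 4 < h 1) ∧ (h 1 < h 2 ∨ h 2 < h 3)

instance (h : Fin 5 → Fin 5) : Decidable (SplitDecreasing h) := by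
  unfold SplitDecreasing; infer_instance

instance (h : Fin 5 → Fin 5) : Decidable (SplitPairs h) := by
  unfold SplitPairs; infer_instance

theorem mem_patterns_iff (p : Equiv.Perm (Fin 5)) :
    p ∈ patterns ↔ SplitDecreasing (p⁻¹ : Equiv.Perm (Fin 5)) ∨
      SplitPairs (p⁻¹ : Equiv.Perm (Fin 5)) := by
  unfold patterns
  rw [Set.mem_ofPred_eq]
  revert p
  decide +kernel

/-- An occurrence is recorded by its values instead of its positions, since the runs of w⁻¹ are what
matters. -/
theorem containsPattern_iff {k : ℕ} (w : Equiv.Perm (Fin n)) (p : Equiv.Perm (Fin k)) :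
    ContainsPattern w p ↔ ∃ g : Fin k → Fin n, StrictMono g ∧
      ∀ a b, w⁻¹ (g a) < w⁻¹ (g b) ↔ p⁻¹ a < p⁻¹ b := by
  constructor
  · rintro ⟨f, hf, h⟩
    exact ⟨fun a => w (f (p⁻¹ a)), fun a b hab => by simpa [h] using hab,
      fun a b => by simp [hf.lt_iff_lt]⟩
  · rintro ⟨g, hg, h⟩
    exact ⟨fun a => w⁻¹ (g (p a)), fun a b hab => (h _ _).mpr (by simpa using hab),
      fun a b => by simp [hg.lt_iff_lt]⟩

theorem exists_standardization {k : ℕ} {h : Fin k → Fin n} (hh : Function.Injective h) :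
    ∃ q : Equiv.Perm (Fin k), ∀ a b, h a < h b ↔ q a < q b := by
  have hc : (Finset.univ.image h).card = k := by simp [Finset.card_image_of_injective _ hh]
  let e := (Finset.univ.image h).orderIsoOfFin hc
  let q : Fin k → Fin k := fun a => e.symm ⟨h a, by simp⟩
  have hq : Function.Injective q := fun a b hab => hh (by simpa [q] using hab)
  refine ⟨Equiv.ofBijective q (Finite.injective_iff_bijective.mp hq), fun a b => ?_⟩
  simp [q]

theorem exists_containsPattern_iff (w : Equiv.Perm (Fin n)) :
    (∃ p ∈ patterns, ContainsPattern w p) ↔ ∃ g : Fin 5 → Fin n, StrictMono g ∧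
      (SplitDecreasing (fun a => w⁻¹ (g a)) ∨ SplitPairs (fun a => w⁻¹ (g a))) := by
  constructor
  · rintro ⟨p, hp, hw⟩
    obtain ⟨g, hg, h⟩ := (containsPattern_iff w p).mp hw
    refine ⟨g, hg, ?_⟩
    rw [mem_patterns_iff] at hp
    simpa only [SplitDecreasing, SplitPairs, h] using hp
  · rintro ⟨g, hg, hs⟩
    obtain ⟨q, hq⟩ := exists_standardization (h := fun a => w⁻¹ (g a))
      (w⁻¹.injective.comp hg.injective)
    refine ⟨q⁻¹, ?_, (containsPattern_iff w _).mpr ⟨g, hg, by simpa using hq⟩⟩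
    rw [mem_patterns_iff]
    simpa only [SplitDecreasing, SplitPairs, hq, inv_inv] using hs

/-! ### Separated triples and pairs -/

/-- Some ascent of `v` lies weakly between the positions `i` and `j`. -/
def Separated (v : Equiv.Perm (Fin n)) (i j : Fin n) : Prop :=
  ∃ k k' : Fin n, (k' : ℕ) = k + 1 ∧ v k < v k' ∧ i ≤ k ∧ k' ≤ j

/-- A decreasing subsequence of length three, with entries in different decreasing runs. -/
def HasSeparatedTriple (v : Equiv.Perm (Fin n)) : Prop :=
  ∃ i₁ i₂ i₃, v i₃ < v i₂ ∧ v i₂ < v i₁ ∧ Separated v i₁ i₂ ∧ Separated v i₂ i₃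

/-- Two entries before an ascent that are larger than two entries after it. -/
def HasSeparatedPairs (v : Equiv.Perm (Fin n)) : Prop :=
  ∃ p q r s k k' : Fin n, (k' : ℕ) = k + 1 ∧ v k < v k' ∧ p ≠ q ∧ r ≠ s ∧
    (p ≤ k ∧ q ≤ k ∧ k' ≤ r ∧ k' ≤ s) ∧ (v r < v p ∧ v s < v p ∧ v r < v q ∧ v s < v q)

/-- Without an ascent in between, v would decrease from i to j. -/
theorem separated_of_lt {v : Equiv.Perm (Fin n)} {i j : Fin n} (hij : i < j) (h : v i < v j) :
    Separated v i j := by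
  by_contra hs
  have key : ∀ t : ℕ, ∀ ht : t < n, (i : ℕ) ≤ t → t ≤ (j : ℕ) → v ⟨t, ht⟩ ≤ v i := by
    intro t
    induction t with
    | zero =>
      intro ht h1 h2
      exact (congrArg v (Fin.ext (by simp; omega) : (⟨0, ht⟩ : Fin n) = i)).le
    | succ t ih =>
      intro ht h1 h2
      rcases Nat.lt_or_ge t i with h3 | h3
      · exact (congrArg v (Fin.ext (by simp; omega) : (⟨t + 1, ht⟩ : Fin n) = i)).le
      · refine le_trans (not_lt.mp fun hlt => hs ?_) (ih (by omega) h3 (by omega))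
        exact ⟨⟨t, by omega⟩, ⟨t + 1, ht⟩, rfl, hlt, h3, h2⟩
  exact absurd (key j j.2 hij.le le_rfl) (not_le.mpr h)

theorem Separated.mono {v : Equiv.Perm (Fin n)} {i j i' j' : Fin n} (h : Separated v i j)
    (hi : i' ≤ i) (hj : j ≤ j') : Separated v i' j' := by
  obtain ⟨k, k', h1, h2, h3, h4⟩ := h
  exact ⟨k, k', h1, h2, hi.trans h3, h4.trans hj⟩

theorem Separated.lt {v : Equiv.Perm (Fin n)} {i j : Fin n} (h : Separated v i j) : i < j := by
  obtain ⟨k, k', h1, h2, h3, h4⟩ := h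
  simp only [Fin.le_def, Fin.lt_def] at *
  omega

theorem strictMono_five {a b c d e : Fin n} (h1 : a < b) (h2 : b < c) (h3 : c < d) (h4 : d < e) :
    StrictMono ![a, b, c, d, e] := by
  rw [Fin.strictMono_iff_lt_succ]
  intro i
  fin_cases i <;> assumption

theorem hasSeparated_of_split {v : Equiv.Perm (Fin n)} {g : Fin 5 → Fin n} (hg : StrictMono g)
    (h : SplitDecreasing (fun a => v (g a)) ∨ SplitPairs (fun a => v (g a))) :
    HasSeparatedTriple v ∨ HasSeparatedPairs v := by
  have h01 : g 0 < g 1 := hg (by decide)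
  have h12 : g 1 < g 2 := hg (by decide)
  have h23 : g 2 < g 3 := hg (by decide)
  have h34 : g 3 < g 4 := hg (by decide)
  rcases h with ⟨⟨h1, h2⟩, h3, h4⟩ | ⟨⟨h1, h2, h3, h4⟩, h5⟩
  · refine .inl ⟨g 0, g 2, g 4, h1, h2, ?_, ?_⟩
    · rcases h3 with h | h
      · exact (separated_of_lt h01 h).mono le_rfl h12.le
      · exact (separated_of_lt h12 h).mono h01.le le_rfl
    · rcases h4 with h | h
      · exact (separated_of_lt h23 h).mono le_rfl h34.le
      · exact (separated_of_lt h34 h).mono h23.le le_rfl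
  · have hs : Separated v (g 1) (g 3) := by
      rcases h5 with h | h
      · exact (separated_of_lt h12 h).mono le_rfl h23.le
      · exact (separated_of_lt h23 h).mono h12.le le_rfl
    obtain ⟨k, k', hk, hv, h6, h7⟩ := hs
    exact .inr ⟨g 0, g 1, g 3, g 4, k, k', hk, hv, h01.ne, h34.ne,
      ⟨h01.le.trans h6, h6, h7, h7.trans h34.le⟩, h1, h3, h2, h4⟩

/-- A separated descent has a witness of the separation strictly in between. -/
theorem exists_between_of_separated {v : Equiv.Perm (Fin n)} {i j : Fin n} (h : Separated v i j)
    (hv : v j < v i) : (∃ x, i < x ∧ x < j ∧ (v i < v x ∨ v x < v j)) ∨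
      ∃ x y, i < x ∧ x < y ∧ y < j ∧ v j < v x ∧ v x < v y ∧ v y < v i := by
  obtain ⟨k, k', hk, hkv, h1, h2⟩ := h
  have hkk : k < k' := by rw [Fin.lt_def]; omega
  rcases lt_or_ge (v k) (v j) with h3 | h3
  · have : k ≠ i := by rintro rfl; exact absurd hv (not_lt.mpr h3.le)
    exact .inl ⟨k, lt_of_le_of_ne h1 this.symm, hkk.trans_le h2, .inr h3⟩
  rcases lt_or_ge (v i) (v k') with h4 | h4
  · have : k' ≠ j := by rintro rfl; exact absurd hv (not_lt.mpr h4.le)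
    exact .inl ⟨k', lt_of_le_of_lt h1 hkk, lt_of_le_of_ne h2 this, .inl h4⟩
  have h5 : k ≠ i := by rintro rfl; exact absurd hkv (not_lt.mpr h4)
  have h6 : k' ≠ j := by rintro rfl; exact absurd hkv (not_lt.mpr h3)
  have h7 : k ≠ j := (hkk.trans_le h2).ne
  have h8 : k' ≠ i := (h1.trans_lt hkk).ne'
  exact .inr ⟨k, k', lt_of_le_of_ne h1 h5.symm, hkk, lt_of_le_of_ne h2 h6,
    lt_of_le_of_ne h3 (v.injective.ne h7.symm), hkv, lt_of_le_of_ne h4 (v.injective.ne h8)⟩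

/-- Single witnesses on both sides give `SplitDecreasing`. An ascent with intermediate values
supplies a second large or a second small entry, hence `SplitPairs`. -/
theorem split_of_separatedTriple {v : Equiv.Perm (Fin n)} (h : HasSeparatedTriple v) :
    ∃ g : Fin 5 → Fin n, StrictMono g ∧
      (SplitDecreasing (fun a => v (g a)) ∨ SplitPairs (fun a => v (g a))) := by
  obtain ⟨i, j, k, hkj, hji, hij, hjk⟩ := h
  rcases exists_between_of_separated hij hji with ⟨x, h1, h2, h3⟩ | ⟨x, y, h1, h2, h3, h4, h5, h6⟩
  · rcases exists_between_of_separated hjk hkj with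
      ⟨y, h4, h5, h6⟩ | ⟨y, z, h4, h5, h6, h7, h8, h9⟩
    · exact ⟨_, strictMono_five h1 h2 h4 h5, .inl ⟨⟨hkj, hji⟩, h3, h6⟩⟩
    · exact ⟨_, strictMono_five hij.lt h4 h5 h6, .inr ⟨⟨h9.trans hji, h9, hkj.trans hji, hkj⟩, .inr h8⟩⟩
  · exact ⟨_, strictMono_five h1 h2 h3 hjk.lt,
      .inr ⟨⟨hji, h4, hkj.trans hji, hkj.trans h4⟩, .inl h5⟩⟩

theorem split_of_separatedPairs {v : Equiv.Perm (Fin n)} (h : HasSeparatedPairs v) :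
    ∃ g : Fin 5 → Fin n, StrictMono g ∧
      (SplitDecreasing (fun a => v (g a)) ∨ SplitPairs (fun a => v (g a))) := by
  obtain ⟨p, q, r, s, k, k', hk, hkv, hpq, hrs, ⟨hp, hq, hr, hs⟩, h1, h2, h3, h4⟩ := h
  wlog hlt : p < q generalizing p q
  · exact this q p hpq.symm hq hp h3 h4 h1 h2 (lt_of_le_of_ne (not_lt.mp hlt) hpq.symm)
  wlog hlt' : r < s generalizing r s
  · exact this s r hrs.symm hs hr h2 h1 h4 h3 (lt_of_le_of_ne (not_lt.mp hlt') hrs.symm)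
  have hkk : k < k' := by rw [Fin.lt_def]; omega
  have hsep : Separated v q r := ⟨k, k', hk, hkv, hq, hr⟩
  rcases exists_between_of_separated hsep h3 with ⟨x, h5, h6, h7⟩ | ⟨x, y, h5, h6, h7, h8, h9, h10⟩
  · exact ⟨_, strictMono_five hlt h5 h6 hlt', .inr ⟨⟨h1, h3, h2, h4⟩, h7⟩⟩
  -- The ascent x, y has values between those of r and q. Either x serves as a large entry, or y
  -- serves as a small one, or q, y, s is a decreasing triple separated by x and r.
  · rcases lt_or_ge (v s) (v x) with h11 | h11
    · exact ⟨_, strictMono_five h5 h6 h7 hlt', .inr ⟨⟨h3, h8, h4, h11⟩, .inl h9⟩⟩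
    rcases lt_or_ge (v y) (v p) with h12 | h12
    · exact ⟨_, strictMono_five hlt h5 h6 h7, .inr ⟨⟨h12, h10, h1, h3⟩, .inr h9⟩⟩
    · have h13 : v x < v s := lt_of_le_of_ne h11 (v.injective.ne ((h6.trans h7).trans hlt').ne)
      exact ⟨_, strictMono_five h5 h6 h7 hlt', .inl ⟨⟨h2.trans_le h12, h10⟩, .inr h9, .inr (h8.trans h13)⟩⟩

/-- Pattern avoidance, in terms of the decreasing runs of `w⁻¹`. -/
theorem avoids_patterns_iff (w : Equiv.Perm (Fin n)) :
    (∀ p ∈ patterns, Avoids w p) ↔ ¬ HasSeparatedTriple w⁻¹ ∧ ¬ HasSeparatedPairs w⁻¹ := by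
  have h : (∀ p ∈ patterns, Avoids w p) ↔ ¬ ∃ p ∈ patterns, ContainsPattern w p := by
    simp [Avoids]
  rw [h, exists_containsPattern_iff, ← not_or]
  refine not_congr ⟨fun ⟨g, hg, hs⟩ => hasSeparated_of_split hg hs, ?_⟩
  rintro (h | h)
  · exact split_of_separatedTriple h
  · exact split_of_separatedPairs h

/-! ### Words without repeated letters -/

theorem wordProd_le_iff {l : List (Fin (n - 1))} {k : ℕ} (h : ∀ a ∈ l, (a : ℕ) ≠ k) (i : Fin n) :
    (wordProd l i : ℕ) ≤ k ↔ (i : ℕ) ≤ k := by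
  induction l with
  | nil => simp
  | cons a l ih =>
    have ha := h a (by simp)
    rw [← ih fun b hb => h b (by simp [hb]), wordProd_cons, Equiv.Perm.mul_apply, simple_val]
    split_ifs <;> omega

/-- Words without repeated letters are reduced. -/
theorem isReducedWord_of_nodup {l : List (Fin (n - 1))} (h : l.Nodup) :
    IsReducedWord (wordProd l) l := by
  refine ⟨rfl, le_antisymm ?_ (length_le_of_wordProd rfl)⟩
  obtain ⟨l', hl', hlen⟩ := exists_isReducedWord (wordProd l)
  rw [← hlen]
  -- Each letter k of `l` occurs in every word for the product: a word without k preserves the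
  -- indices up to k, whereas the single k in `l` carries some index across this cut.
  refine (h.subperm fun k hk => ?_).length_le
  by_contra hk'
  obtain ⟨A, B, rfl⟩ := List.append_of_mem hk
  have hA : ∀ a ∈ A, (a : ℕ) ≠ k := by
    intro a ha e
    rw [Fin.ext e] at ha
    exact (List.nodup_append.mp h).2.2 k ha k (by simp) rfl
  have hB : ∀ b ∈ B, (b : ℕ) ≠ k := by
    intro b hb e
    rw [Fin.ext e] at hb
    exact (List.nodup_cons.mp (List.nodup_append.mp h).2.1).1 hb
  have hk2 := k.2
  let i : Fin n := (wordProd B)⁻¹ ⟨k, by omega⟩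
  have h1 := wordProd_le_iff (l := l') (k := k) (fun a ha e => hk' (by rwa [← Fin.ext e])) i
  have h2 : (wordProd B i : ℕ) = k := by simp [i]
  have h3 := wordProd_le_iff hB i
  rw [hl', wordProd_append, wordProd_cons, Equiv.Perm.mul_apply, wordProd_le_iff hA,
    Equiv.Perm.mul_apply, simple_val, if_pos h2] at h1
  omega

/-- Remove letters in `J` from the left as long as the length goes down. -/
theorem exists_parabolic_factor (J : Set (Fin (n - 1))) (w : Equiv.Perm (Fin n)) :
    ∃ l u, (∀ a ∈ l, a ∈ J) ∧ w = wordProd l * u ∧ length w = l.length + length u ∧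
      ∀ a ∈ J, a ∉ leftDescents u := by
  induction hk : length w using Nat.strong_induction_on generalizing w with
  | _ k ih =>
    by_cases h : ∃ a ∈ J, a ∈ leftDescents w
    · obtain ⟨a, haJ, ha⟩ := h
      have ha' : length (simple a * w) < length w := ha
      obtain ⟨l, u, h1, h2, h3, h4⟩ := ih _ (hk ▸ ha') (simple a * w) rfl
      have hw : w = wordProd (a :: l) * u := by
        rw [wordProd_cons, mul_assoc, ← h2, ← mul_assoc]; simp
      refine ⟨a :: l, u, by simpa [haJ] using h1, hw, ?_, h4⟩
      obtain ⟨l', hl', hlen⟩ := exists_isReducedWord (simple a * w)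
      have h5 : length w ≤ (a :: l').length := length_le_of_wordProd (by
        rw [wordProd_cons, hl', ← mul_assoc]; simp)
      simp only [List.length_cons] at h5 ⊢
      omega
    · push Not at h
      exact ⟨[], w, by simp, by simp, by simp [hk], h⟩

theorem lt_of_fixes {x : Equiv.Perm (Fin n)} {m : ℕ} (hx : ∀ i : Fin n, m ≤ i → x i = i)
    {i : Fin n} (hi : (i : ℕ) < m) : (x i : ℕ) < m := by
  by_contra h
  have h1 := x.injective (hx (x i) (not_lt.mp h))
  rw [h1] at h
  exact h hi

theorem lt_of_fixes_of_inversion {x : Equiv.Perm (Fin n)} {m : ℕ}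
    (hx : ∀ i : Fin n, m ≤ i → x i = i) {i j : Fin n} (hij : i < j) (h : x j < x i) :
    (j : ℕ) < m := by
  by_contra hj
  have h1 := hx j (not_lt.mp hj)
  have h2 : m ≤ x i := by rw [h1, Fin.lt_def] at h; omega
  have h3 := x.injective (hx (x i) h2)
  rw [h1, h3] at h
  exact absurd hij (not_lt.mpr h.le)

theorem simple_lt_simple {a : Fin (n - 1)} {i j : Fin n} (hij : i < j) (hj : (j : ℕ) < a + 1) :
    simple a i < simple a j := by
  simp only [Fin.lt_def, simple_val] at *
  split_ifs <;> omega

/-- Permutations that avoid `321` and all patterns with two entries larger than the two that follow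
have a word without repeated letters. -/
theorem exists_nodup_word (m : ℕ) (x : Equiv.Perm (Fin n)) (hx : ∀ i : Fin n, m ≤ i → x i = i)
    (h3 : ∀ i j k, i < j → j < k → x k < x j → ¬ x j < x i)
    (h4 : ∀ i j k l, i < j → j < k → k < l → x k < x i → x k < x j → x l < x i → ¬ x l < x j) :
    ∃ l, wordProd l = x ∧ l.Nodup ∧ ∀ a ∈ l, (a : ℕ) + 1 < m := by
  induction m generalizing x with
  | zero => exact ⟨[], by ext i; simp [hx i], by simp, by simp⟩
  | succ m ih =>
    by_cases hfix : ∀ i : Fin n, m ≤ i → x i = i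
    · obtain ⟨l, h1, h2, h⟩ := ih x hfix h3 h4
      exact ⟨l, h1, h2, fun a ha => (h a ha).trans (by omega)⟩
    push Not at hfix
    obtain ⟨M, hM, hxM⟩ := hfix
    have hMm : (M : ℕ) = m := by
      by_contra h
      exact hxM (hx M (by omega))
    have hlt : (x M : ℕ) < m := by
      have h1 := lt_of_fixes hx (i := M) (by omega)
      have h2 : (x M : ℕ) ≠ M := fun h => hxM (Fin.ext h)
      omega
    have hMn := M.2
    obtain ⟨N, hN⟩ : ∃ N : Fin n, (N : ℕ) + 1 = m := ⟨⟨m - 1, by omega⟩, by simp; omega⟩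
    obtain ⟨a, ha⟩ : ∃ a : Fin (n - 1), (a : ℕ) + 1 = m := ⟨⟨m - 1, by omega⟩, by simp; omega⟩
    have hsM : simple a M = N := Fin.ext (by rw [simple_val, if_neg, if_pos] <;> omega)
    have hsN : simple a N = M := by rw [← hsM, simple_simple]
    have hsi : ∀ i : Fin n, M < i → simple a i = i := by
      intro i hi
      rw [Fin.lt_def] at hi
      exact Fin.ext (by rw [simple_val, if_neg, if_neg] <;> omega)
    -- Otherwise the values M and N both occur before position M, and x M < N. If M comes first,
    -- this is a 321. If N comes first, the entry right after M and the entry at position M are two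
    -- smaller ones.
    have hcase : x N = M ∨ x M = N := by
      by_contra hne
      push Not at hne
      obtain ⟨q, hq⟩ := x.surjective M
      obtain ⟨t, ht⟩ := x.surjective N
      have hqm : (q : ℕ) ≤ m := by
        by_contra h
        have := hx q (by omega)
        rw [hq] at this
        omega
      have htm : (t : ℕ) ≤ m := by
        by_contra h
        have := hx t (by omega)
        rw [ht] at this
        omega
      have hqN : q ≠ N := by rintro rfl; exact hne.1 hq
      have hqM : q ≠ M := by rintro rfl; exact hxM hq
      have htM : t ≠ M := by rintro rfl; exact hne.2 ht
      have htq : t ≠ q := by rintro rfl; rw [hq] at ht; omega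
      have hxM' : (x M : ℕ) ≠ N := fun h => hne.2 (Fin.ext h)
      rw [Ne, Fin.ext_iff] at hqN hqM htM htq
      rcases Nat.lt_or_ge q t with h | h
      · refine h3 q t M h ?_ ?_ ?_ <;> simp only [hq, ht, Fin.lt_def] <;> omega
      · let r : Fin n := ⟨q + 1, by omega⟩
        have hr : (r : ℕ) = q + 1 := rfl
        have hrm := lt_of_fixes hx (i := r) (by omega)
        have h5 : (x r : ℕ) ≠ M := by
          rw [← hq]
          exact fun e => by have := x.injective (Fin.ext e); rw [Fin.ext_iff] at this; omega
        have h6 : (x r : ℕ) ≠ N := by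
          rw [← ht]
          exact fun e => by have := x.injective (Fin.ext e); rw [Fin.ext_iff] at this; omega
        refine h4 t q r M ?_ ?_ ?_ ?_ ?_ ?_ ?_ <;> simp only [hq, ht, Fin.lt_def] <;> omega
    rcases hcase with h | h
    -- Here `simple a` is increasing on the positions below m, so forbidden subsequences of the
    -- product come from x. The recursive word has only letters below a, so appending a creates no
    -- repetition.
    · have hfix : ∀ i : Fin n, m ≤ i → (x * simple a) i = i := by
        intro i hi
        rcases eq_or_lt_of_le hi with e | e
        · obtain rfl : i = M := Fin.ext (by omega)
          rw [Equiv.Perm.mul_apply, hsM, h]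
        · rw [Equiv.Perm.mul_apply, hsi i (by rw [Fin.lt_def]; omega), hx i e]
      have hmono : ∀ i j : Fin n, i < j → (j : ℕ) < m → simple a i < simple a j :=
        fun i j hij hj => simple_lt_simple hij (by omega)
      obtain ⟨l, h1, h2, h⟩ := ih (x * simple a) hfix
        (fun i j k hij hjk hkj hji => by
          have hk := lt_of_fixes_of_inversion hfix hjk hkj
          exact h3 _ _ _ (hmono _ _ hij (by omega)) (hmono _ _ hjk hk) hkj hji)
        (fun i j k l hij hjk hkl hki hkj hli hlj => by
          have hk := lt_of_fixes_of_inversion hfix (hjk.trans hkl) hlj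
          exact h4 _ _ _ _ (hmono _ _ hij (by omega)) (hmono _ _ hjk (by omega)) (hmono _ _ hkl hk)
            hki hkj hli hlj)
      refine ⟨l ++ [a], by rw [wordProd_append, h1, mul_assoc]; simp, ?_, ?_⟩
      · rw [List.nodup_append]
        refine ⟨h2, by simp, fun b hb c hc e => ?_⟩
        rw [List.mem_singleton] at hc
        have := h b hb
        rw [e, hc] at this
        omega
      · intro b hb
        rcases List.mem_append.mp hb with hb | hb
        · exact (h b hb).trans (by omega)
        · rw [List.mem_singleton.mp hb]; omega
    -- The mirror case, with values in place of positions.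
    · have hfix : ∀ i : Fin n, m ≤ i → (simple a * x) i = i := by
        intro i hi
        rcases eq_or_lt_of_le hi with e | e
        · obtain rfl : i = M := Fin.ext (by omega)
          rw [Equiv.Perm.mul_apply, h, hsN]
        · rw [Equiv.Perm.mul_apply, hx i e, hsi i (by rw [Fin.lt_def]; omega)]
      have hmono : ∀ i j : Fin n, (i : ℕ) < m → (simple a * x) j < (simple a * x) i →
          x j < x i := by
        intro i j hi hij
        have h1 := lt_of_fixes hfix hi
        simpa using simple_lt_simple hij (by omega : _ < (a : ℕ) + 1)
      obtain ⟨l, h1, h2, h⟩ := ih (simple a * x) hfix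
        (fun i j k hij hjk hkj hji => by
          have hk := lt_of_fixes_of_inversion hfix hjk hkj
          exact h3 _ _ _ hij hjk (hmono _ _ (by omega) hkj) (hmono _ _ (by omega) hji))
        (fun i j k l hij hjk hkl hki hkj hli hlj => by
          have hk := lt_of_fixes_of_inversion hfix (hjk.trans hkl) hlj
          exact h4 _ _ _ _ hij hjk hkl (hmono _ _ (by omega) hki) (hmono _ _ (by omega) hkj)
            (hmono _ _ (by omega) hli) (hmono _ _ (by omega) hlj))
      refine ⟨a :: l, by rw [wordProd_cons, h1, ← mul_assoc]; simp, ?_, ?_⟩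
      · refine List.nodup_cons.mpr ⟨fun hb => ?_, h2⟩
        have := h a hb
        omega
      · intro b hb
        rcases List.mem_cons.mp hb with rfl | hb
        · omega
        · exact (h b hb).trans (by omega)

/-! ### Sufficiency: a parabolic factor and a word without repetitions -/

theorem simple_comm {a b : Fin (n - 1)} (h : (a : ℕ) + 1 < b ∨ (b : ℕ) + 1 < a) :
    simple a * simple b = simple b * simple a := by
  ext i
  simp only [Equiv.Perm.mul_apply, simple_val]
  split_ifs <;> omega

open Classical in
theorem wordProd_filter {l : List (Fin (n - 1))} {C : Set (Fin (n - 1))}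
    (h : ∀ a ∈ l, a ∈ C → ∀ b ∈ l, b ∉ C → (a : ℕ) + 1 < b ∨ (b : ℕ) + 1 < a) :
    wordProd l = wordProd (l.filter (fun i => decide (i ∈ C))) *
      wordProd (l.filter (fun i => decide (i ∉ C))) := by
  induction l with
  | nil => simp
  | cons a l ih =>
    have ih := ih fun b hb hbC c hc => h b (by simp [hb]) hbC c (by simp [hc])
    by_cases ha : a ∈ C
    · simp [ha, ih, mul_assoc]
    · have hcomm : ∀ l' : List (Fin (n - 1)), (∀ b ∈ l', b ∈ l ∧ b ∈ C) →
          simple a * wordProd l' = wordProd l' * simple a := by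
        intro l' hl'
        induction l' with
        | nil => simp
        | cons b l' ih' =>
          obtain ⟨hb, hbC⟩ := hl' b (by simp)
          rw [wordProd_cons, ← mul_assoc,
            simple_comm (h b (by simp [hb]) hbC a (by simp) ha).symm, mul_assoc,
            ih' fun c hc => hl' c (by simp [hc]), mul_assoc]
      simp only [wordProd_cons, ih, List.filter_cons, ha, decide_false, Bool.false_eq_true,
        if_false, not_false_eq_true, decide_true, if_true]
      rw [← mul_assoc, hcomm _ (by simp), mul_assoc]

theorem wordProd_mem_parabolic {l : List (Fin (n - 1))} {C : Set (Fin (n - 1))}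
    (h : ∀ a ∈ l, a ∈ C) : wordProd l ∈ parabolic C := by
  induction l with
  | nil => exact one_mem _
  | cons a l ih =>
    rw [wordProd_cons]
    exact mul_mem (Subgroup.subset_closure ⟨a, h a (by simp), rfl⟩)
      (ih fun b hb => h b (by simp [hb]))

theorem length_le_longest {C : Set (Fin (n - 1))} {u : Equiv.Perm (Fin n)}
    (hu : u ∈ parabolic C) : length u ≤ length (longest C) :=
  (exists_longest C).choose_spec.2 u hu

theorem longest_mem (C : Set (Fin (n - 1))) : longest C ∈ parabolic C :=
  (exists_longest C).choose_spec.1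

/-- A reduced word has at most `ℓ(w_0(C))` letters in `C`, if its letters in `C` commute with all
others. -/
theorem countIn_le_of_reduced {w : Equiv.Perm (Fin n)} {l : List (Fin (n - 1))}
    (hl : IsReducedWord w l) {C : Set (Fin (n - 1))}
    (h : ∀ a ∈ l, a ∈ C → ∀ b ∈ l, b ∉ C → (a : ℕ) + 1 < b ∨ (b : ℕ) + 1 < a) :
    countIn l C ≤ length (longest C) := by
  classical
  set A := l.filter (fun i => decide (i ∈ C)) with hA
  set B := l.filter (fun i => decide (i ∉ C)) with hB
  have hAB : A.length + B.length = l.length := by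
    rw [hA, hB, ← List.countP_eq_length_filter, ← List.countP_eq_length_filter,
      List.length_eq_countP_add_countP (fun i => decide (i ∈ C))]
    simp
  have hc : countIn l C = A.length := by
    rw [hA, ← List.countP_eq_length_filter]; unfold countIn; congr
  -- With `A` replaced by a reduced word of its product, the word still represents w, so `A` is
  -- reduced itself.
  obtain ⟨A', hA', hlen⟩ := exists_isReducedWord (wordProd A)
  have h1 : length w ≤ (A' ++ B).length := length_le_of_wordProd (by
    rw [wordProd_append, hA', ← wordProd_filter h, hl.1])
  have h2 : length (wordProd A) ≤ length (longest C) :=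
    length_le_longest (wordProd_mem_parabolic fun a ha => by
      simpa using (List.mem_filter.mp ha).2)
  have h3 := hl.2
  rw [List.length_append] at h1
  omega

theorem not_adj_of_mem_componentSet {J : Set (Fin (n - 1))}
    (C : ((dynkin n).induce J).ConnectedComponent) {a b : Fin (n - 1)} (ha : a ∈ componentSet C)
    (hb : b ∈ J) (hbC : b ∉ componentSet C) : (a : ℕ) + 1 < b ∨ (b : ℕ) + 1 < a := by
  obtain ⟨⟨a, haJ⟩, haC, rfl⟩ := ha
  have hne : a ≠ b := by
    rintro rfl
    exact hbC ⟨_, haC, rfl⟩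
  by_contra h
  have hadj : ((dynkin n).induce J).Adj ⟨a, haJ⟩ ⟨b, hb⟩ := by
    simp only [SimpleGraph.comap_adj, dynkin, SimpleGraph.pathGraph_adj,
      Function.Embedding.subtype_apply]
    rw [Ne, Fin.ext_iff] at hne
    simp only at h
    omega
  refine hbC ⟨⟨b, hb⟩, ?_, rfl⟩
  rw [SimpleGraph.ConnectedComponent.mem_supp_iff] at haC ⊢
  rw [← haC]
  exact SimpleGraph.ConnectedComponent.sound hadj.symm.reachable

theorem isSpherical_of_not_separated {w : Equiv.Perm (Fin n)} (h3 : ¬ HasSeparatedTriple w⁻¹)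
    (h4 : ¬ HasSeparatedPairs w⁻¹) : IsSpherical w := by
  classical
  obtain ⟨l₀, u, hJ, hw, hlen, hu⟩ := exists_parabolic_factor (leftDescents w) w
  have hx : ∀ i, u⁻¹ i = w⁻¹ (wordProd l₀ i) := by
    intro i
    conv_rhs => rw [hw]
    simp
  -- an inversion of `u⁻¹` has a non-descent of `w⁻¹` in between, also after applying `wordProd l₀`
  have hsep : ∀ i j, i < j → u⁻¹ j < u⁻¹ i → ∃ k k' : Fin n, (k' : ℕ) = k + 1 ∧
      w⁻¹ k < w⁻¹ k' ∧ (∀ p, p ≤ i → wordProd l₀ p ≤ k) ∧ ∀ q, j ≤ q → k' ≤ wordProd l₀ q := by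
    intro i j hij hji
    by_contra hcon
    -- Here u⁻¹ increases from i to j: at a letter in J because u has no left descent there. A
    -- letter outside J would give the excluded ascent, since it is missing from `l₀`, whose product
    -- therefore preserves the cut.
    have key : ∀ t : ℕ, ∀ ht : t < n, (i : ℕ) ≤ t → t ≤ (j : ℕ) → u⁻¹ i ≤ u⁻¹ ⟨t, ht⟩ := by
      intro t
      induction t with
      | zero =>
        intro ht h1 h2
        exact (congrArg _ (Fin.ext (by simp; omega) : i = (⟨0, ht⟩ : Fin n))).le
      | succ t ih =>
        intro ht h1 h2
        rcases Nat.lt_or_ge t i with h | h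
        · exact (congrArg _ (Fin.ext (by simp; omega) : i = (⟨t + 1, ht⟩ : Fin n))).le
        refine (ih (by omega) h (by omega)).trans ?_
        let a : Fin (n - 1) := ⟨t, by omega⟩
        by_cases ha : a ∈ leftDescents w
        · exact not_lt.mp fun hlt => hu a ha ((mem_leftDescents (i := ⟨t, by omega⟩)
            (j := ⟨t + 1, ht⟩) rfl rfl).mpr hlt)
        · exfalso
          have hb : ∀ p, (wordProd l₀ p : ℕ) ≤ t ↔ (p : ℕ) ≤ t := wordProd_le_iff (k := t)
            fun b hb e => ha (by rw [show a = b from Fin.ext e.symm]; exact hJ b hb)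
          rw [mem_leftDescents (i := ⟨t, by omega⟩) (j := ⟨t + 1, ht⟩) rfl rfl, not_lt] at ha
          refine hcon ⟨⟨t, by omega⟩, ⟨t + 1, ht⟩, rfl, lt_of_le_of_ne ha
            (w⁻¹.injective.ne (by simp)), fun p hp => ?_, fun q hq => ?_⟩
          · rw [Fin.le_def] at hp ⊢
            exact (hb p).mpr (by omega)
          · have := (hb q).not
            rw [Fin.le_def] at hq ⊢
            simp only
            omega
    exact absurd hji (not_lt.mpr (key j j.2 hij.le le_rfl))
  obtain ⟨l, hl, hnd, -⟩ := exists_nodup_word n u⁻¹ (fun i hi => absurd i.2 (by omega))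
    (fun i j k hij hjk hkj hji => by
      obtain ⟨a, a', h5, h6, h7, h8⟩ := hsep i j hij hji
      obtain ⟨b, b', h9, h10, h11, h12⟩ := hsep j k hjk hkj
      exact h3 ⟨wordProd l₀ i, wordProd l₀ j, wordProd l₀ k, by rwa [← hx, ← hx],
        by rwa [← hx, ← hx], ⟨a, a', h5, h6, h7 i le_rfl, h8 j le_rfl⟩,
        ⟨b, b', h9, h10, h11 j le_rfl, h12 k le_rfl⟩⟩)
    (fun i j k l hij hjk hkl hki hkj hli hlj => by
      obtain ⟨a, a', h5, h6, h7, h8⟩ := hsep j k hjk hkj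
      refine h4 ⟨wordProd l₀ i, wordProd l₀ j, wordProd l₀ k, wordProd l₀ l, a, a', h5, h6,
        (wordProd l₀).injective.ne hij.ne, (wordProd l₀).injective.ne hkl.ne,
        ⟨h7 i hij.le, h7 j le_rfl, h8 k le_rfl, h8 l hkl.le⟩, ?_⟩
      simp only [← hx]
      exact ⟨hki, hli, hkj, hlj⟩)
  have hlu : wordProd l.reverse = u := by rw [wordProd_reverse, hl, inv_inv]
  have hnd' : l.reverse.Nodup := List.nodup_reverse.mpr hnd
  have hred := isReducedWord_of_nodup hnd'
  rw [hlu] at hred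
  have hl₀ : IsReducedWord (wordProd l₀) l₀ := by
    refine ⟨rfl, le_antisymm ?_ (length_le_of_wordProd rfl)⟩
    obtain ⟨l', hl', hlen'⟩ := exists_isReducedWord (wordProd l₀)
    have h1 : length w ≤ (l' ++ l.reverse).length := length_le_of_wordProd (by
      rw [wordProd_append, hl', hlu, ← hw])
    have h2 := hred.2
    rw [List.length_append] at h1
    omega
  refine ⟨l₀ ++ l.reverse, ⟨by rw [wordProd_append, hlu, ← hw], ?_⟩, fun j hj => ?_, fun C => ?_⟩
  · rw [List.length_append, hred.2, hlen]
  · rw [List.count_append, List.count_eq_zero_of_not_mem fun h => hj (hJ j h), zero_add]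
    exact List.nodup_iff_count_le_one.mp hnd' j
  · have h1 : countIn l₀ (componentSet C) ≤ length (longest (componentSet C)) :=
      countIn_le_of_reduced hl₀ fun a _ haC b hb hbC =>
        not_adj_of_mem_componentSet C haC (hJ b hb) hbC
    have h2 : countIn l.reverse (componentSet C) ≤ (componentSet C).ncard := by
      unfold countIn
      rw [List.countP_eq_length_filter, ← List.toFinset_card_of_nodup (hnd'.filter _),
        ← Set.ncard_coe_finset]
      refine Set.ncard_le_ncard (fun a ha => ?_) (Set.toFinite _)
      simpa using (List.mem_filter.mp (List.mem_toFinset.mp ha)).2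
    have h3 : countIn (l₀ ++ l.reverse) (componentSet C) =
        countIn l₀ (componentSet C) + countIn l.reverse (componentSet C) := List.countP_append
    omega

/-! ### Barriers that are crossed once -/

/-- At most one letter of the word exchanges the positions `a - 1` and `a`. -/
def CrossedOnce (l : List (Fin (n - 1))) (a : ℕ) : Prop :=
  ∀ s t, ∀ (hs : s < l.length) (ht : t < l.length), (l[s] : ℕ) + 1 = a → (l[t] : ℕ) + 1 = a → s = t

theorem crossing_letter {l : List (Fin (n - 1))} {a t : ℕ} {i : Fin n}
    (h : ¬ ((pos l (t + 1) i : ℕ) < a ↔ (pos l t i : ℕ) < a)) :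
    ∃ ht : t < l.length, (l[t] : ℕ) + 1 = a ∧
      ((pos l t i : ℕ) < a → (pos l t i : ℕ) + 1 = a) ∧ (a ≤ (pos l t i : ℕ) → (pos l t i : ℕ) = a) := by
  rcases Nat.lt_or_ge t l.length with ht | ht
  · refine ⟨ht, ?_⟩
    rw [pos_succ ht, Equiv.Perm.mul_apply, simple_val] at h
    split_ifs at h <;> omega
  · exact absurd (by rw [pos, pos, List.take_of_length_le ht, List.take_of_length_le (by omega)]) h

/-- If a barrier is crossed once, then each ball that crosses it does so at that time. -/
theorem CrossedOnce.exists_time {l : List (Fin (n - 1))} {a : ℕ} (hl : CrossedOnce l a)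
    {i : Fin n} {t : ℕ} (h : ¬ ((pos l t i : ℕ) < a ↔ (i : ℕ) < a)) :
    ∃ τ, ∃ hτ : τ < l.length, (l[τ] : ℕ) + 1 = a ∧
      (∀ s, (pos l s i : ℕ) < a ↔ ((i : ℕ) < a ↔ s ≤ τ)) ∧
      ((i : ℕ) < a → (pos l τ i : ℕ) + 1 = a) ∧ (a ≤ (i : ℕ) → (pos l τ i : ℕ) = a) := by
  obtain ⟨τ, -, -, h1, h2⟩ := exists_change (A := fun s => ((pos l s i : ℕ) < a ↔ (i : ℕ) < a))
    (Nat.zero_le t) (by simp) h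
  obtain ⟨hτ, h3, h4, h5⟩ := crossing_letter (l := l) (a := a) (t := τ) (i := i) fun e => h2 (e.trans h1)
  have hbefore : ∀ s, s ≤ τ → ((pos l s i : ℕ) < a ↔ (i : ℕ) < a) := by
    intro s hs
    by_contra hcon
    obtain ⟨σ, -, hσ, h6, h7⟩ := exists_change
      (A := fun s => ((pos l s i : ℕ) < a ↔ (i : ℕ) < a)) (Nat.zero_le s) (by simp) hcon
    obtain ⟨hσ', h8, -⟩ := crossing_letter (l := l) (a := a) (t := σ) (i := i) fun e => h7 (e.trans h6)
    have := hl _ _ hσ' hτ h8 h3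
    omega
  have hafter : ∀ s, τ + 1 ≤ s → ¬ ((pos l s i : ℕ) < a ↔ (i : ℕ) < a) := by
    intro s hs hcon
    obtain ⟨σ, hσ, -, h6, h7⟩ := exists_change
      (A := fun s => ¬ ((pos l s i : ℕ) < a ↔ (i : ℕ) < a)) hs h2 (not_not.mpr hcon)
    obtain ⟨hσ', h8, -⟩ := crossing_letter (l := l) (a := a) (t := σ) (i := i) fun e =>
      h6 (e.symm.trans (not_not.mp h7))
    have := hl _ _ hσ' hτ h8 h3
    omega
  refine ⟨τ, hτ, h3, fun s => ?_, fun hi => h4 (h1.mpr hi), fun hi => h5 ?_⟩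
  · rcases Nat.lt_or_ge τ s with hs | hs
    · have := hafter s hs
      omega
    · have := hbefore s hs
      tauto
  · exact not_lt.mp fun h' => absurd (h1.mp h') (not_lt.mpr hi)

/-- At the only crossing time both balls sit at position a - 1. -/
theorem CrossedOnce.eq_of_left {l : List (Fin (n - 1))} {a : ℕ} (hl : CrossedOnce l a)
    {i j : Fin n} (hi : (i : ℕ) < a) (hj : (j : ℕ) < a) {s t : ℕ} (hs : a ≤ (pos l s i : ℕ))
    (ht : a ≤ (pos l t j : ℕ)) : i = j := by
  obtain ⟨σ, h1, h2, -, h3, -⟩ := hl.exists_time (i := i) (t := s) (by omega)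
  obtain ⟨τ, h4, h5, -, h6, -⟩ := hl.exists_time (i := j) (t := t) (by omega)
  obtain rfl := hl _ _ h1 h4 h2 h5
  have := h3 hi
  have := h6 hj
  exact (pos l σ).injective (Fin.ext (by omega))

theorem CrossedOnce.eq_of_right {l : List (Fin (n - 1))} {a : ℕ} (hl : CrossedOnce l a)
    {i j : Fin n} (hi : a ≤ (i : ℕ)) (hj : a ≤ (j : ℕ)) {s t : ℕ} (hs : (pos l s i : ℕ) < a)
    (ht : (pos l t j : ℕ) < a) : i = j := by
  obtain ⟨σ, h1, h2, -, -, h3⟩ := hl.exists_time (i := i) (t := s) (by omega)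
  obtain ⟨τ, h4, h5, -, -, h6⟩ := hl.exists_time (i := j) (t := t) (by omega)
  obtain rfl := hl _ _ h1 h4 h2 h5
  have := h3 hi
  have := h6 hj
  exact (pos l σ).injective (Fin.ext (by omega))

theorem CrossedOnce.right_of_left {l : List (Fin (n - 1))} {a : ℕ} (hl : CrossedOnce l a)
    {i : Fin n} (hi : (i : ℕ) < a) {s t : ℕ} (hst : s ≤ t) (hs : a ≤ (pos l s i : ℕ)) :
    a ≤ (pos l t i : ℕ) := by
  obtain ⟨τ, -, -, h, -⟩ := hl.exists_time (i := i) (t := s) (by omega)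
  have h1 := h s
  have h2 := h t
  simp only [hi, true_iff] at h1 h2
  omega

theorem CrossedOnce.left_of_right {l : List (Fin (n - 1))} {a : ℕ} (hl : CrossedOnce l a)
    {i : Fin n} (hi : a ≤ (i : ℕ)) {s t : ℕ} (hst : s ≤ t) (hs : (pos l s i : ℕ) < a) :
    (pos l t i : ℕ) < a := by
  obtain ⟨τ, -, -, h, -⟩ := hl.exists_time (i := i) (t := s) (by omega)
  have h1 := h s
  have h2 := h t
  simp only [not_lt.mpr hi, false_iff] at h1 h2
  omega

/-- The two balls that cross a barrier do so at the same time. -/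
theorem CrossedOnce.simultaneous {l : List (Fin (n - 1))} {a : ℕ} (hl : CrossedOnce l a)
    {i j : Fin n} (hi : (i : ℕ) < a) (hj : a ≤ (j : ℕ)) {s t : ℕ} (hs : a ≤ (pos l s i : ℕ))
    (ht : (pos l t j : ℕ) < a) (r : ℕ) : a ≤ (pos l r i : ℕ) ↔ (pos l r j : ℕ) < a := by
  obtain ⟨σ, h1, h2, h3, -⟩ := hl.exists_time (i := i) (t := s) (by omega)
  obtain ⟨τ, h4, h5, h6, -⟩ := hl.exists_time (i := j) (t := t) (by omega)
  obtain rfl := hl _ _ h1 h4 h2 h5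
  have h7 := h3 r
  have h8 := h6 r
  simp only [hi, true_iff, not_lt.mpr hj, false_iff] at h7 h8
  omega

theorem crossedOnce_of_count {l : List (Fin (n - 1))} {J : Set (Fin (n - 1))}
    (h : ∀ j, j ∉ J → l.count j ≤ 1) {a : ℕ} (ha : ∀ k : Fin (n - 1), (k : ℕ) + 1 = a → k ∉ J) :
    CrossedOnce l a := by
  intro s t hs ht h1 h2
  by_contra hne
  have hk := h _ (ha _ h1)
  have he : l[t] = l[s] := Fin.ext (by omega)
  have := card_le_countP (p := (· == l[s])) l {s, t} (by
    intro r hr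
    rcases Finset.mem_insert.mp hr with rfl | hr
    · exact ⟨hs, by simp⟩
    · obtain rfl := Finset.mem_singleton.mp hr
      exact ⟨ht, by simpa using he⟩)
  rw [Finset.card_pair hne] at this
  rw [List.count] at hk
  omega

/-- At most one of p, q crosses the barrier, so the other ends on its left. Then r and s, which end
still further left, both cross, which is one ball too many. Neither (S.2) nor reducedness plays a
role. -/
theorem not_separatedPairs_of_count {w : Equiv.Perm (Fin n)} {l : List (Fin (n - 1))}
    (hl : wordProd l = w) (h : ∀ j, j ∉ leftDescents w → l.count j ≤ 1) :
    ¬ HasSeparatedPairs w⁻¹ := by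
  rintro ⟨p, q, r, s, k, k', hk, hkv, hpq, hrs, ⟨hp, hq, hr, hs⟩, h1, h2, h3, h4⟩
  have hc : CrossedOnce l k' := crossedOnce_of_count h fun a ha => by
    rw [mem_leftDescents (i := k) (j := k') (by omega) (by omega)]
    exact not_lt.mpr hkv.le
  simp only [← hl, ← pos_length, Fin.lt_def, Fin.le_def] at *
  have hor : (pos l l.length p : ℕ) < k' ∨ (pos l l.length q : ℕ) < k' := by
    by_contra hcon
    push Not at hcon
    exact hpq (hc.eq_of_left (by omega) (by omega) hcon.1 hcon.2)
  exact hrs (hc.eq_of_right hr hs (s := l.length) (t := l.length) (by omega) (by omega))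

/-! ### Blocks of positions and components of J(w) -/

/-- The maximal run of indices of `J` around a position. -/
theorem exists_block (J : Set (Fin (n - 1))) (m : Fin n) : ∃ a b : Fin n, a ≤ m ∧ m ≤ b ∧
    (∀ k : Fin (n - 1), (a : ℕ) ≤ k → (k : ℕ) < b → k ∈ J) ∧
    (∀ k : Fin (n - 1), (k : ℕ) + 1 = a → k ∉ J) ∧ ∀ k : Fin (n - 1), (k : ℕ) = b → k ∉ J := by
  classical
  have h1 : ∃ a : ℕ, ∀ k : Fin (n - 1), a ≤ k → (k : ℕ) < m → k ∈ J :=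
    ⟨m, fun k h h' => absurd h' (not_lt.mpr h)⟩
  -- The bound n - 1 is not the index of any letter, so there the condition is vacuous.
  have h2 : ∃ b : ℕ, (m : ℕ) ≤ b ∧ ∀ k : Fin (n - 1), (k : ℕ) = b → k ∉ J :=
    ⟨n - 1, by omega, fun k hk => absurd k.2 (by omega)⟩
  have ham : Nat.find h1 ≤ m := Nat.find_min' h1 fun k h h' => absurd h' (not_lt.mpr h)
  have hbn : Nat.find h2 ≤ n - 1 :=
    Nat.find_min' h2 ⟨by omega, fun k hk => absurd k.2 (by omega)⟩
  have hm := m.2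
  refine ⟨⟨Nat.find h1, by omega⟩, ⟨Nat.find h2, by omega⟩, ham, (Nat.find_spec h2).1,
    fun k hak hkb => ?_, fun k hk hkJ => ?_, (Nat.find_spec h2).2⟩
  · rcases Nat.lt_or_ge k m with h | h
    · exact Nat.find_spec h1 k hak h
    · have := Nat.find_min h2 hkb
      push Not at this
      obtain ⟨k', hk', hJ⟩ := this h
      rwa [← Fin.ext hk']
  · simp only at hk
    refine Nat.find_min h1 (m := k) (by omega) fun k' h h' => ?_
    rcases eq_or_lt_of_le h with e | e
    · rwa [← Fin.ext e]
    · exact Nat.find_spec h1 k' (by omega) h'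

/-- A path in the induced graph cannot leave the run, because the letters that border it are outside
J. -/
theorem componentSet_eq {J : Set (Fin (n - 1))} {a b : ℕ}
    (hJ : ∀ k : Fin (n - 1), a ≤ k → (k : ℕ) < b → k ∈ J)
    (ha : ∀ k : Fin (n - 1), (k : ℕ) + 1 = a → k ∉ J) (hb : ∀ k : Fin (n - 1), (k : ℕ) = b → k ∉ J)
    {c : Fin (n - 1)} (hca : (c : ℕ) = a) (hcb : a < b) :
    componentSet (((dynkin n).induce J).connectedComponentMk ⟨c, hJ c hca.ge (by omega)⟩) =
      {k : Fin (n - 1) | a ≤ k ∧ (k : ℕ) < b} := by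
  have hadj : ∀ x y : J, ((dynkin n).induce J).Adj x y ↔
      ((x.1 : ℕ) + 1 = y.1 ∨ (y.1 : ℕ) + 1 = x.1) := by
    intro x y
    simp [dynkin, SimpleGraph.pathGraph_adj]
  have hmem : ∀ x : J, x ∈ (((dynkin n).induce J).connectedComponentMk
      ⟨c, hJ c hca.ge (by omega)⟩).supp ↔ ((dynkin n).induce J).Reachable ⟨c, hJ c hca.ge (by omega)⟩ x := by
    intro x
    rw [SimpleGraph.ConnectedComponent.mem_supp_iff, SimpleGraph.ConnectedComponent.eq]
    exact SimpleGraph.reachable_comm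
  ext k
  constructor
  · rintro ⟨x, hx, rfl⟩
    rw [hmem, SimpleGraph.reachable_iff_reflTransGen] at hx
    induction hx with
    | refl => exact ⟨hca.ge, by simp only; omega⟩
    | @tail y z _ hyz ih =>
      obtain ⟨h1, h2⟩ := ih
      have h3 := (hadj y z).mp hyz
      have h4 : (z.1 : ℕ) + 1 ≠ a := fun h => ha z.1 h z.2
      have h5 : (z.1 : ℕ) ≠ b := fun h => hb z.1 h z.2
      exact ⟨by omega, by omega⟩
  · rintro ⟨h1, h2⟩
    refine ⟨⟨k, hJ k h1 h2⟩, (hmem _).mpr ?_, rfl⟩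
    have key : ∀ t : ℕ, ∀ ht : t < n - 1, ∀ hat : a ≤ t, ∀ htb : t < b,
        ((dynkin n).induce J).Reachable ⟨c, hJ c hca.ge (by omega)⟩
          ⟨⟨t, ht⟩, hJ ⟨t, ht⟩ hat htb⟩ := by
      intro t
      induction t with
      | zero =>
        intro ht hat htb
        have : c = ⟨0, ht⟩ := Fin.ext (by simp; omega)
        subst this
        exact SimpleGraph.Reachable.refl _
      | succ t ih =>
        intro ht hat htb
        rcases eq_or_lt_of_le hat with e | e
        · have : c = ⟨t + 1, ht⟩ := Fin.ext (by simp; omega)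
          subst this
          exact SimpleGraph.Reachable.refl _
        · refine (ih (by omega) (by omega) (by omega)).trans (SimpleGraph.Adj.reachable ?_)
          rw [hadj]
          exact .inl rfl
    exact key k k.2 h1 h2

theorem apply_eq_of_mem_parabolic {a b : ℕ} {u : Equiv.Perm (Fin n)}
    (hu : u ∈ parabolic {k : Fin (n - 1) | a ≤ k ∧ (k : ℕ) < b}) {i : Fin n}
    (hi : (i : ℕ) < a ∨ b < (i : ℕ)) : u i = i := by
  induction hu using Subgroup.closure_induction with
  | mem x hx =>
    obtain ⟨k, ⟨h1, h2⟩, rfl⟩ := hx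
    exact Fin.ext (by rw [simple_val, if_neg, if_neg] <;> omega)
  | one => rfl
  | mul x y _ _ hx hy => rw [Equiv.Perm.mul_apply, hy, hx]
  | inv x _ hx => rw [Equiv.Perm.inv_eq_iff_eq, hx]

/-- The parabolic subgroup fixes everything outside the positions a, …, b, so all inversions lie
inside. -/
theorem length_longest_le (a b : Fin n) :
    length (longest {k : Fin (n - 1) | (a : ℕ) ≤ k ∧ (k : ℕ) < b}) ≤
      (Finset.univ.filter fun e : Fin n × Fin n => a ≤ e.1 ∧ e.1 < e.2 ∧ e.2 ≤ b).card := by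
  set u := longest {k : Fin (n - 1) | (a : ℕ) ≤ k ∧ (k : ℕ) < b} with hu
  have hu' : u⁻¹ ∈ parabolic {k : Fin (n - 1) | (a : ℕ) ≤ k ∧ (k : ℕ) < b} :=
    inv_mem (longest_mem _)
  refine (length_le_card_inversions u).trans (Finset.card_le_card fun e he => ?_)
  obtain ⟨h1, h2⟩ := (Finset.mem_filter.mp he).2
  refine Finset.mem_filter.mpr ⟨Finset.mem_univ _, ?_, h1, ?_⟩
  · by_contra h
    rw [not_le, Fin.lt_def] at h
    rw [apply_eq_of_mem_parabolic hu' (i := e.1) (.inl h)] at h2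
    have h3 := apply_eq_of_mem_parabolic hu' (i := u⁻¹ e.2) (.inl (by rw [Fin.lt_def] at h2; omega))
    rw [u⁻¹.injective h3] at h2
    exact absurd h1 (not_lt.mpr h2.le)
  · by_contra h
    rw [not_le, Fin.lt_def] at h
    rw [apply_eq_of_mem_parabolic hu' (i := e.2) (.inr h)] at h2
    have h3 := apply_eq_of_mem_parabolic hu' (i := u⁻¹ e.1) (.inr (by rw [Fin.lt_def] at h2; omega))
    rw [u⁻¹.injective h3] at h2
    exact absurd h1 (not_lt.mpr h2.le)

theorem ncard_run_le (a b : ℕ) : {k : Fin (n - 1) | a ≤ k ∧ (k : ℕ) < b}.ncard ≤ b - a := by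
  rw [← Nat.card_Ico a b, ← Set.ncard_coe_finset]
  exact Set.ncard_le_ncard_of_injOn (fun k : Fin (n - 1) => (k : ℕ))
    (fun k hk => Finset.mem_coe.mpr (Finset.mem_Ico.mpr hk)) (fun k _ k' _ h => Fin.ext h) (Finset.finite_toSet _)

/-- The exchanges of a ball on the left of a block and a ball on its right with each other and with
the balls of the block come on top of those within the block. -/
theorem card_swaps_ge {a b γ α : Fin n} (hγ : γ < a) (hα : b < α)
    {E : Finset (Fin n × Fin n)} (hE : ∀ i j, a ≤ i → i < j → j ≤ b → (i, j) ∈ E) :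
    (Finset.univ.filter fun e : Fin n × Fin n => a ≤ e.1 ∧ e.1 < e.2 ∧ e.2 ≤ b).card +
      ((Finset.Icc a b).filter fun y => (γ, y) ∈ E).card +
      ((Finset.Icc a b).filter fun y => (y, α) ∈ E).card + (E ∩ {(γ, α)}).card ≤ E.card := by
  rw [← Finset.card_image_of_injective ((Finset.Icc a b).filter fun y => (γ, y) ∈ E)
      (Prod.mk_right_injective γ),
    ← Finset.card_image_of_injective ((Finset.Icc a b).filter fun y => (y, α) ∈ E)
      (Prod.mk_left_injective α), ← Finset.card_union_of_disjoint,
      ← Finset.card_union_of_disjoint, ← Finset.card_union_of_disjoint]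
  · refine Finset.card_le_card fun e he => ?_
    simp only [Finset.mem_union, Finset.mem_filter, Finset.mem_image, Finset.mem_inter] at he
    rcases he with ((⟨-, h1, h2, h3⟩ | ⟨y, ⟨-, hy⟩, rfl⟩) | ⟨y, ⟨-, hy⟩, rfl⟩) | ⟨he, -⟩
    · exact hE _ _ h1 h2 h3
    · exact hy
    · exact hy
    · exact he
  all_goals
    rw [Finset.disjoint_left]
    rintro ⟨i, j⟩
    simp only [Finset.mem_union, Finset.mem_filter, Finset.mem_image, Finset.mem_inter,
      Finset.mem_singleton, Prod.mk.injEq, Finset.mem_Icc, Fin.le_def, Fin.lt_def,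
      Finset.mem_univ, true_and, Fin.ext_iff] at *
    try grind

/-! ### Necessity: counting exchanges in the block of the middle ball -/

theorem not_separatedTriple_of_isSpherical {w : Equiv.Perm (Fin n)} (h : IsSpherical w) :
    ¬ HasSeparatedTriple w⁻¹ := by
  classical
  obtain ⟨l, hl, hS1, hS2⟩ := h
  rintro ⟨γ, β, α, hαβ, hβγ, hsepγ, hsepα⟩
  obtain ⟨a, b, haβ, hβb, hJ, hJa, hJb⟩ := exists_block (leftDescents w) β
  -- both outer balls start outside the block
  have hnot : ∀ k k' : Fin n, (k' : ℕ) = k + 1 → w⁻¹ k < w⁻¹ k' →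
      ∀ c : Fin (n - 1), (c : ℕ) = k → c ∉ leftDescents w := by
    intro k k' hk hkv c hc
    rw [mem_leftDescents (i := k) (j := k') hc.symm (by omega)]
    exact not_lt.mpr hkv.le
  have hγa : γ < a := by
    obtain ⟨k, k', hk, hkv, h1, h2⟩ := hsepγ
    by_contra hcon
    have hk'2 := k'.2
    simp only [Fin.le_def, Fin.lt_def] at *
    exact hnot k k' hk hkv ⟨k, by omega⟩ rfl (hJ _ (by simp only; omega) (by simp only; omega))
  have hαb : b < α := by
    obtain ⟨k, k', hk, hkv, h1, h2⟩ := hsepα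
    by_contra hcon
    have hk'2 := k'.2
    simp only [Fin.le_def, Fin.lt_def] at *
    exact hnot k k' hk hkv ⟨k, by omega⟩ rfl (hJ _ (by simp only; omega) (by simp only; omega))
  have hca : CrossedOnce l a := crossedOnce_of_count hS1 hJa
  have hcb : CrossedOnce l (b + 1) := crossedOnce_of_count hS1 fun k hk => hJb k (by omega)
  -- the bound on the number of letters in the block
  set C : Set (Fin (n - 1)) := {k | (a : ℕ) ≤ k ∧ (k : ℕ) < b} with hC
  have hcount : countIn l C ≤ (Finset.univ.filter fun e : Fin n × Fin n =>
      a ≤ e.1 ∧ e.1 < e.2 ∧ e.2 ≤ b).card + ((b : ℕ) - a) := by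
    -- A block of one position has no letters and corresponds to no component.
    rcases Nat.lt_or_ge a b with hab | hab
    · have hb2 := b.2
      have h1 := hS2 (((dynkin n).induce (leftDescents w)).connectedComponentMk
        ⟨⟨a, by omega⟩, hJ ⟨a, by omega⟩ le_rfl hab⟩)
      rw [componentSet_eq hJ hJa hJb (c := ⟨a, by omega⟩) rfl hab] at h1
      have h2 := length_longest_le a b
      have h3 := ncard_run_le (n := n) a b
      exact h1.trans (add_le_add h2 h3)
    · have : C = ∅ := by
        ext k
        simp only [hC, Set.mem_ofPred_eq, Set.mem_empty_iff_false, iff_false]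
        omega
      rw [this]
      simp [countIn]
  -- exchanges within the block
  let E : Finset (Fin n × Fin n) := Finset.univ.filter fun e =>
    ∃ t, ∃ h : t < l.length, SwapAt l t e.1 e.2 ∧ l[t] ∈ C
  have hEC : E.card ≤ countIn l C := card_swaps_le_countIn E fun e he => (Finset.mem_filter.mp he).2
  have hmemE : ∀ i j, i < j → w⁻¹ j < w⁻¹ i →
      (∀ t, (pos l t j : ℕ) = pos l t i + 1 → (pos l (t + 1) i : ℕ) = pos l t j →
        (pos l (t + 1) j : ℕ) = pos l t i → a ≤ (pos l t i : ℕ) ∧ (pos l t j : ℕ) ≤ b) →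
      (i, j) ∈ E := by
    intro i j hij hji hin
    obtain ⟨t, ht⟩ := exists_swapAt_of_inversion hl.1 hij hji
    obtain ⟨h1, h2⟩ := ht.after
    have ht' := ht
    obtain ⟨h3, h4, h5⟩ := ht'
    have h6 := hin t (by omega) h1 h2
    exact Finset.mem_filter.mpr ⟨Finset.mem_univ _, t, h3, ht, by
      show (a : ℕ) ≤ l[t] ∧ (l[t] : ℕ) < b
      omega⟩
  have hend : ∀ i, w⁻¹ i = pos l l.length i := fun i => by rw [pos_length, hl.1]
  have hdesc : ∀ i j, a ≤ i → i < j → j ≤ b → w⁻¹ j < w⁻¹ i := by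
    intro i j hai hij hjb
    by_contra hcon
    obtain ⟨k, k', hk, hkv, h1, h2⟩ := separated_of_lt hij
      (lt_of_le_of_ne (not_lt.mp hcon) (w⁻¹.injective.ne hij.ne))
    have hk'2 := k'.2
    simp only [Fin.le_def, Fin.lt_def] at hai hij hjb h1 h2
    exact hnot k k' hk hkv ⟨k, by omega⟩ rfl (hJ _ (by simp only; omega) (by simp only; omega))
  simp only [Fin.lt_def, Fin.le_def] at hγa hαb haβ hβb
  -- An exchange outside the block would take two of its balls across the same barrier in the same
  -- direction.
  have hblock : ∀ i j, a ≤ i → i < j → j ≤ b → (i, j) ∈ E := by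
    intro i j hai hij hjb
    refine hmemE i j hij (hdesc i j hai hij hjb) fun t h1 h2 h3 => ?_
    simp only [Fin.lt_def, Fin.le_def] at hai hij hjb
    constructor
    · by_contra hcon
      have := hca.eq_of_right (i := i) (j := j) (s := t) (t := t + 1) (by omega) (by omega)
        (by omega) (by omega)
      omega
    · by_contra hcon
      have := hcb.eq_of_left (i := i) (j := j) (s := t + 1) (t := t) (by omega) (by omega)
        (by omega) (by omega)
      omega
  -- It remains to show that `G`, `A` and the pair (γ, α) contribute at least b - a + 1, the number
  -- of balls of the block.
  have hge := card_swaps_ge hγa hαb hblock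
  set G := (Finset.Icc a b).filter fun y => (γ, y) ∈ E with hG
  set A := (Finset.Icc a b).filter fun y => (y, α) ∈ E with hA
  -- the balls that leave the block
  let L := (Finset.Icc a b).filter fun y => ∃ t, (pos l t y : ℕ) < a
  let R := (Finset.Icc a b).filter fun y => ∃ t, (b : ℕ) + 1 ≤ pos l t y
  have hL : ∀ y : Fin n, y ∈ L ↔ ((a : ℕ) ≤ y ∧ (y : ℕ) ≤ b) ∧ ∃ t, (pos l t y : ℕ) < a := by
    exact fun y => Finset.mem_filter.trans (and_congr_left' Finset.mem_Icc)
  have hR : ∀ y : Fin n, y ∈ R ↔ ((a : ℕ) ≤ y ∧ (y : ℕ) ≤ b) ∧ ∃ t, (b : ℕ) + 1 ≤ pos l t y := by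
    exact fun y => Finset.mem_filter.trans (and_congr_left' Finset.mem_Icc)
  have hL1 : L.card ≤ 1 := Finset.card_le_one.mpr fun x hx y hy => by
    obtain ⟨hx, s, hs⟩ := (hL x).mp hx
    obtain ⟨hy, t, ht⟩ := (hL y).mp hy
    exact hca.eq_of_right hx.1 hy.1 hs ht
  have hR1 : R.card ≤ 1 := Finset.card_le_one.mpr fun x hx y hy => by
    obtain ⟨hx, s, hs⟩ := (hR x).mp hx
    obtain ⟨hy, t, ht⟩ := (hR y).mp hy
    exact hcb.eq_of_left (by omega) (by omega) hs ht
  -- The balls that never leave the block: all but at most two. Each meets γ or α inside, as v(α) <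
  -- v(γ).
  let S := Finset.Icc a b \ (L ∪ R)
  have hS : ∀ y : Fin n, y ∈ S → ((a : ℕ) ≤ y ∧ (y : ℕ) ≤ b) ∧
      ∀ t, (a : ℕ) ≤ pos l t y ∧ (pos l t y : ℕ) ≤ b := by
    intro y hy
    obtain ⟨h1, h2⟩ := Finset.mem_sdiff.mp hy
    rw [Finset.mem_Icc, Fin.le_def, Fin.le_def] at h1
    rw [Finset.mem_union, hL, hR] at h2
    push Not at h2
    refine ⟨h1, fun t => ⟨h2.1 h1 t, ?_⟩⟩
    have := h2.2 h1 t
    omega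
  have hScard : (b : ℕ) + 1 - a ≤ S.card + (L.card + R.card) := by
    have h1 : (Finset.Icc a b).card ≤ S.card + (L ∪ R).card :=
      tsub_le_iff_right.mp (Finset.le_card_sdiff (L ∪ R) (Finset.Icc a b))
    have h2 := Finset.card_union_le L R
    rw [Fin.card_Icc] at h1
    omega
  have hmemG : ∀ y : Fin n, (a : ℕ) ≤ y → (y : ℕ) ≤ b → (γ, y) ∈ E → y ∈ G := fun y h1 h2 h3 =>
    Finset.mem_filter.mpr ⟨Finset.mem_Icc.mpr ⟨h1, h2⟩, h3⟩
  have hmemA : ∀ y : Fin n, (a : ℕ) ≤ y → (y : ℕ) ≤ b → (y, α) ∈ E → y ∈ A := fun y h1 h2 h3 =>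
    Finset.mem_filter.mpr ⟨Finset.mem_Icc.mpr ⟨h1, h2⟩, h3⟩
  have hSG : ∀ y ∈ S, w⁻¹ y < w⁻¹ γ → y ∈ G := by
    intro y hy hlt
    obtain ⟨h1, h2⟩ := hS y hy
    refine hmemG y h1.1 h1.2 (hmemE _ _ (by rw [Fin.lt_def]; omega) hlt fun t h3 h4 h5 => ?_)
    have h6 := h2 t
    have h7 := h2 (t + 1)
    omega
  have hSA : ∀ y ∈ S, w⁻¹ α < w⁻¹ y → y ∈ A := by
    intro y hy hlt
    obtain ⟨h1, h2⟩ := hS y hy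
    refine hmemA y h1.1 h1.2 (hmemE _ _ (by rw [Fin.lt_def]; omega) hlt fun t h3 h4 h5 => ?_)
    have h6 := h2 t
    have h7 := h2 (t + 1)
    omega
  have hSGA : S ⊆ G ∪ A := by
    intro y hy
    rw [Finset.mem_union]
    rcases lt_or_ge (w⁻¹ y) (w⁻¹ γ) with h | h
    · exact .inl (hSG y hy h)
    · exact .inr (hSA y hy ((hαβ.trans hβγ).trans_le h))
  have hβS : β ∈ S → β ∈ G ∩ A := fun hβ =>
    Finset.mem_inter.mpr ⟨hSG β hβ hβγ, hSA β hβ hαβ⟩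
  have hGA := Finset.card_union_add_card_inter G A
  have hSle := Finset.card_le_card hSGA
  have hβS' : β ∉ S → (β ∈ L ∨ β ∈ R) := by
    intro hβ
    by_contra hcon
    exact hβ (Finset.mem_sdiff.mpr ⟨Finset.mem_Icc.mpr ⟨haβ, hβb⟩, by
      rwa [Finset.mem_union]⟩)
  -- both outer balls enter the block
  have hγend : (a : ℕ) ≤ pos l l.length γ := by
    by_contra hcon
    -- Otherwise α and β, which end to the left of γ, would both cross the barrier a leftwards.
    rw [hend, hend, Fin.lt_def] at hαβ hβγ
    have := hca.eq_of_right (i := α) (j := β) (s := l.length) (t := l.length) (by omega) haβ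
      (by omega) (by omega)
    omega
  have hαend : (pos l l.length α : ℕ) < b + 1 := by
    by_contra hcon
    rw [hend, hend, Fin.lt_def] at hαβ hβγ
    have := hcb.eq_of_left (i := γ) (j := β) (s := l.length) (t := l.length) (by omega) (by omega)
      (by omega) (by omega)
    omega
  by_cases hγR : ∃ t, (b : ℕ) + 1 ≤ pos l t γ
  · -- the left outer ball passes through the block
    obtain ⟨t₁, ht₁⟩ := hγR
    have hRe : ∀ y : Fin n, (a : ℕ) ≤ y → (y : ℕ) ≤ b → ∀ t, (pos l t y : ℕ) ≤ b := by
      intro y hay hyb t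
      by_contra hcon
      have := hcb.eq_of_left (i := γ) (j := y) (s := t₁) (t := t) (by omega) (by omega) ht₁
        (by omega)
      omega
    have hR0 : R.card = 0 := Finset.card_eq_zero.mpr (Finset.eq_empty_of_forall_notMem fun y hy => by
      obtain ⟨hy, t, ht⟩ := (hR y).mp hy
      have := hRe y hy.1 hy.2 t
      omega)
    -- Then β counts in both `G` and `A`, which makes up for the one ball that may leave on the
    -- left. If β itself left there, it would cross a together with γ, while α crosses the right
    -- barrier together with γ. So when β and α have been exchanged, γ is already beyond the block
    -- and β is left of a, and α would be a second ball crossing a leftwards.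
    have hβ : β ∈ S := by
      by_contra hβ
      rcases hβS' hβ with hβ | hβ
      · obtain ⟨-, t₀, ht₀⟩ := (hL β).mp hβ
        obtain ⟨t, ht⟩ := exists_swapAt_of_inversion hl.1 (i := β) (j := α)
          (by rw [Fin.lt_def]; omega) hαβ
        have h1 := ht.after
        obtain ⟨_, h2, h3⟩ := ht
        have h4 := hca.simultaneous hγa haβ hγend ht₀ (t + 1)
        have h5 := hcb.simultaneous (i := γ) (j := α) (by omega) (by omega) ht₁ hαend (t + 1)
        have h6 := hRe β haβ hβb (t + 1)
        have := hca.eq_of_right (i := α) (j := β) (s := t + 1) (t := t₀) (by omega) haβ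
          (by omega) ht₀
        omega
      · rw [Finset.card_eq_zero.mp hR0] at hβ
        simp at hβ
    have := Finset.card_pos.mpr ⟨β, hβS hβ⟩
    omega
  by_cases hαL : ∃ t, (pos l t α : ℕ) < a
  · -- the right outer ball passes through the block
    obtain ⟨t₁, ht₁⟩ := hαL
    have hLe : ∀ y : Fin n, (a : ℕ) ≤ y → (y : ℕ) ≤ b → ∀ t, (a : ℕ) ≤ pos l t y := by
      intro y hay hyb t
      by_contra hcon
      have := hca.eq_of_right (i := α) (j := y) (s := t₁) (t := t) (by omega) (by omega) ht₁
        (by omega)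
      omega
    have hL0 : L.card = 0 := Finset.card_eq_zero.mpr (Finset.eq_empty_of_forall_notMem fun y hy => by
      obtain ⟨hy, t, ht⟩ := (hL y).mp hy
      have := hLe y hy.1 hy.2 t
      omega)
    have hβ : β ∈ S := by
      by_contra hβ
      rcases hβS' hβ with hβ | hβ
      · rw [Finset.card_eq_zero.mp hL0] at hβ
        simp at hβ
      · obtain ⟨-, t₀, ht₀⟩ := (hR β).mp hβ
        obtain ⟨t, ht⟩ := exists_swapAt_of_inversion hl.1 (i := γ) (j := β)
          (by rw [Fin.lt_def]; omega) hβγ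
        have h1 := ht.after
        obtain ⟨_, h2, h3⟩ := ht
        have h4 := hca.simultaneous (i := γ) (j := α) hγa (by omega) hγend ht₁ (t + 1)
        have h5 := hcb.simultaneous (i := β) (j := α) (by omega) (by omega) ht₀ hαend (t + 1)
        have h6 := hLe β haβ hβb (t + 1)
        have := hcb.eq_of_left (i := γ) (j := β) (s := t + 1) (t := t₀) (by omega) (by omega)
          (by omega) ht₀
        omega
    have := Finset.card_pos.mpr ⟨β, hβS hβ⟩
    omega
  -- the outer balls are exchanged inside the block
  push Not at hγR hαL
  have hγα : (γ, α) ∈ E := by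
    refine hmemE γ α (by rw [Fin.lt_def]; omega) (hαβ.trans hβγ) fun t h1 h2 h3 => ?_
    have h4 := hγR (t + 1)
    have h5 := hαL (t + 1)
    omega
  have hD : (E ∩ {(γ, α)}).card = 1 := by
    rw [Finset.inter_singleton_of_mem hγα, Finset.card_singleton]
  -- Up to two balls may be missing from `S`. The pair (γ, α) makes up for one, and β for the other:
  -- it lies in both `G` and `A` if it stays, and in their union outside `S` if it leaves.
  by_cases hβ : β ∈ S
  · have := Finset.card_pos.mpr ⟨β, hβS hβ⟩
    omega
  · have hβGA : β ∈ G ∪ A := by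
      rw [Finset.mem_union]
      rcases hβS' hβ with hβ | hβ
      · obtain ⟨-, t₀, ht₀⟩ := (hL β).mp hβ
        refine .inr (hmemA β haβ hβb (hmemE β α (by rw [Fin.lt_def]; omega) hαβ
          fun t h1 h2 h3 => ?_))
        have h4 := hαL (t + 1)
        refine ⟨by omega, ?_⟩
        by_contra hcon
        -- A ball that has crossed one barrier never returns, so β cannot be beyond both ends of the
        -- block at different times.
        rcases le_total t₀ (t + 1) with h | h
        · have := hca.left_of_right (i := β) haβ h ht₀
          omega
        · have := hcb.right_of_left (i := β) (by omega) h (by omega)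
          omega
      · obtain ⟨-, t₀, ht₀⟩ := (hR β).mp hβ
        refine .inl (hmemG β haβ hβb (hmemE γ β (by rw [Fin.lt_def]; omega) hβγ
          fun t h1 h2 h3 => ?_))
        have h4 := hγR (t + 1)
        refine ⟨?_, by omega⟩
        by_contra hcon
        rcases le_total t₀ (t + 1) with h | h
        · have := hcb.right_of_left (i := β) (by omega) h ht₀
          omega
        · have := hca.left_of_right (i := β) haβ h (by omega)
          omega
    have h1 := Finset.card_le_card (Finset.insert_subset hβGA hSGA)
    rw [Finset.card_insert_of_notMem hβ] at h1
    omega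

end Spherical

theorem theorem1p3 {n : ℕ} (w : Equiv.Perm (Fin n)) :
    Spherical.IsSpherical w ↔ ∀ p ∈ Spherical.patterns, Spherical.Avoids w p := by
  rw [Spherical.avoids_patterns_iff]
  constructor
  · intro h
    refine ⟨Spherical.not_separatedTriple_of_isSpherical h, ?_⟩
    obtain ⟨l, hl, hS, -⟩ := h
    exact Spherical.not_separatedPairs_of_count hl.1 hS
  · rintro ⟨h3, h4⟩
    exact Spherical.isSpherical_of_not_separated h3 h4
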